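/- **Setting.** Let $(x_t,y_t)_{t\ge 1}$ be a stochastic process with values in $\mathbb{R}^d\times\mathcal Y$ ($\mathcal Y$ a measurable space), let $\mathcal F_t=\sigma((x_1,y_1),\dots,(x_t,y_t))$, and let $\Pi$ be a probability distribution on $\mathbb{R}^d\times\mathcal Y$. Put $$\phi(k)=\sup\bigl\{\,2\,d_{\rm TV}\bigl(\mathbb P((x_{t+k},y_{t+k})\in\cdot\mid A),\Pi\bigr)\;:\;t\ge 1,\ A\in\mathcal F_t,\ \mathbb P(A)>0\,\bigr\},\qquad d_{\rm TV}(P,Q)=\sup_A|P(A)-Q(A)| .$$ Assume that $\Pi$ and the laws of all $(x_t,y_t)$ are absolutely continuous with respect to a measure $\nu$, and that $\|x\|_2\le B$ for $\nu$-almost every $(x,y)$. Let $\mathcal W\subset\mathbb{R}^d$ be compact and convex with $\|w\|_2\le R$ for all $w\in\mathcal W$. Let $\ell:\mathcal Y\times\mathbb R\to\mathbb R$ be measurable, and let $\ell'$ be measurable, such that for some $\lambda>0$ and $G_\ell$, for all $y\in\mathcal Y$ and all $a,b\in[-RB,RB]$, $$\ell(y,b)\ge \ell(y,a)+\ell'(y,a)(b-a)+\tfrac{\lambda}{2}(b-a)^2,\qquad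 |\ell(y,b)-\ell(y,a)|\le G_\ell|a-b|,$$ where $\ell'(y,\cdot)$ is the derivative, or a selection of subgradients, and at the endpoints satisfies $|\ell'(y,\pm RB)|\le G_\ell$ (at interior points this bound is automatic). Put $F(w;(x,y))=\ell(y,\langle x,w\rangle)$ and $\nabla F(w;(x,y))=\ell'(y,\langle x,w\rangle)\,x$. Suppose that $F(w;\cdot)$ is $\Pi$-integrable for $w\in\mathcal W$, put $f(w)=\mathbb E_\Pi[F(w;(x,y))]$, let $w^*\in\arg\min_{w\in\mathcal W}f(w)$, and let $\mathrm{Cov}:=\mathbb E_\Pi[xx^\top]$ satisfy $\lambda_{\min}(\mathrm{Cov})>0$. Let the iterates be given for $t\ge1$ by the modified follow-the-approximate-leader update (with $\epsilon=1$) $$w(t)=\operatorname*{argmin}_{w\in\mathcal W}\Bigl\{\sum_{i=1}^{t-1}\langle\nabla F(w(i);(x_i,y_i)),w\rangle+\frac{\lambda}{2}\sum_{i=1}^{t-1}\langle w(i)-w,x_i\rangle^2+\frac{\lambda}{2}w^\top(x_tx_t^\top+I)w\Bigr\},$$ and let $\widehat w_n=\frac1n\sum_{t=1}^n w(t)$.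 **Theorem.** For every $n\ge 1$ and $\delta\in(0,1)$, with probability at least $1-4\delta\log n$, for all integers $\tau\ge1$ simultaneously, $$\begin{aligned} f(\widehat w_n)-f(w^*)\le{}& \frac{G_\ell^2 d}{\lambda n}(9+14\tau)\log(B^2n+1)+\frac{\lambda}{n}\|w^*\|_2^2+\frac{32\,G_\ell^2B^2\tau}{\lambda n\,\lambda_{\min}(\mathrm{Cov})}\log\frac{\tau}{\delta}\\&+\frac{8\tau G_\ell^2}{\lambda n}\Bigl(3\log\frac{\tau}{\delta}+1\Bigr)+\frac{4G_\ell^2}{\lambda}\phi(\tau).\end{aligned}$$ -/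

import Mathlib

open MeasureTheory ProbabilityTheory

noncomputable section

namespace LinearPrediction

/-- Total variation distance `sup_A |P(A) - Q(A)|` over measurable sets `A`. -/
def tvDist {S : Type*} [MeasurableSpace S] (P Q : Measure S) : ℝ :=
  ⨆ A : {A : Set S // MeasurableSet A}, |P.real A - Q.real A|

/-- The σ-field `σ(ξ₁, …, ξ_t)`.  Samples are indexed from `1`; the value at index `0` is never
used. -/
abbrev history {Ω S : Type*} [MeasurableSpace S] (ξ : ℕ → Ω → S) (t : ℕ) : MeasurableSpace Ω :=
  ⨆ i ∈ Finset.Icc 1 t, MeasurableSpace.comap (ξ i) inferInstance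

/-- The (weak) `φ`-mixing coefficient
`φ(k) = sup { 2 d_TV(law of ξ_{t+k} given B, Π) : t ≥ 1, B ∈ σ(ξ₁, …, ξ_t), ℙ(B) > 0 }`.
All the members of the set lie in `[0, 2]`. -/
def phiMixing {Ω S : Type*} [MeasurableSpace Ω] [MeasurableSpace S]
    (P : Measure Ω) (ξ : ℕ → Ω → S) (Pi : Measure S) (k : ℕ) : ℝ :=
  sSup {r : ℝ | ∃ t : ℕ, 1 ≤ t ∧ ∃ B : Set Ω, MeasurableSet[history ξ t] B ∧ P B ≠ 0 ∧
    r = 2 * tvDist ((ProbabilityTheory.cond P B).map (ξ (t + k))) Pi}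

/-- For each label `y`, the loss `ℓ(y, ·)` is `lam`-strongly convex and `G`-Lipschitz on
`[-r, r]`, and `ℓ'(y, ·)` is a selection of its subgradients there.
The last field only concerns the endpoints: for `|a| < r` the bound `|ℓ'(y, a)| ≤ G` is a
consequence of the other two, but at `a = ± r` the subdifferential of a function on `[-r, r]` is
unbounded and the selection has to be one of the subgradients of size at most `G`. -/
structure LinearStrongConvexity {Y : Type*} (loss loss' : Y → ℝ → ℝ) (lam G r : ℝ) : Prop where
  strong_convex : ∀ y : Y, ∀ a b : ℝ, |a| ≤ r → |b| ≤ r →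
    loss y a + loss' y a * (b - a) + lam / 2 * (b - a) ^ 2 ≤ loss y b
  lipschitz : ∀ y : Y, ∀ a b : ℝ, |a| ≤ r → |b| ≤ r → |loss y b - loss y a| ≤ G * |a - b|
  endpoint_bound : ∀ y : Y, ∀ a : ℝ, |a| = r → |loss' y a| ≤ G

/-- The instantaneous loss `F(w; (x, y)) = ℓ(y, ⟨x, w⟩)`. -/
def sampleLoss {d : ℕ} {Y : Type*} (loss : Y → ℝ → ℝ)
    (w : EuclideanSpace ℝ (Fin d)) (z : EuclideanSpace ℝ (Fin d) × Y) : ℝ :=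
  loss z.2 (inner ℝ z.1 w)

/-- The (sub)gradient `∇F(w; (x, y)) = ℓ'(y, ⟨x, w⟩) x` in `w`. -/
def sampleGrad {d : ℕ} {Y : Type*} (loss' : Y → ℝ → ℝ)
    (w : EuclideanSpace ℝ (Fin d)) (z : EuclideanSpace ℝ (Fin d) × Y) :
    EuclideanSpace ℝ (Fin d) :=
  loss' z.2 (inner ℝ z.1 w) • z.1

/-- The risk `f(w) = E_Π[F(w; (x, y))]`. -/
def risk {d : ℕ} {Y : Type*} [MeasurableSpace Y] (loss : Y → ℝ → ℝ)
    (Pi : Measure (EuclideanSpace ℝ (Fin d) × Y)) (w : EuclideanSpace ℝ (Fin d)) : ℝ :=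
  ∫ z, sampleLoss loss w z ∂Pi

/-- The matrix `E_Π[x xᵀ]`. -/
def secondMoment {d : ℕ} {Y : Type*} [MeasurableSpace Y]
    (Pi : Measure (EuclideanSpace ℝ (Fin d) × Y)) : Matrix (Fin d) (Fin d) ℝ :=
  Matrix.of fun i j => ∫ z, z.1 i * z.1 j ∂Pi

/-- Smallest eigenvalue of a real symmetric matrix. -/
def lambdaMin {d : ℕ} (M : Matrix (Fin d) (Fin d) ℝ) : ℝ :=
  sInf (spectrum ℝ M)

/-- The objective minimized at time `t`, for the samples `z 1, z 2, …` and the earlier plays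
`w 1, …, w (t - 1)`:
`∑_{i<t} ⟨∇F(w(i); z_i), v⟩ + lam/2 ∑_{i<t} ⟨w(i) - v, x_i⟩² + lam/2 vᵀ(x_t x_tᵀ + ε I)v`. -/
def ftalObjective {d : ℕ} {Y : Type*} (loss' : Y → ℝ → ℝ) (lam eps : ℝ)
    (z : ℕ → EuclideanSpace ℝ (Fin d) × Y) (w : ℕ → EuclideanSpace ℝ (Fin d)) (t : ℕ)
    (v : EuclideanSpace ℝ (Fin d)) : ℝ :=
  ∑ i ∈ Finset.Ico 1 t, inner ℝ (sampleGrad loss' (w i) (z i)) v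
    + lam / 2 * ∑ i ∈ Finset.Ico 1 t, (inner ℝ (w i - v) (z i).1) ^ 2
    + lam / 2 * ((inner ℝ (z t).1 v) ^ 2 + eps * ‖v‖ ^ 2)

/-- `w 1, w 2, …` are the plays of the modified follow-the-approximate-leader algorithm over `W`
on the samples `z 1, z 2, …`: each `w t` minimizes the objective at time `t` over `W`. -/
def IsFTAL {d : ℕ} {Y : Type*} (loss' : Y → ℝ → ℝ) (lam eps : ℝ)
    (W : Set (EuclideanSpace ℝ (Fin d)))
    (z : ℕ → EuclideanSpace ℝ (Fin d) × Y) (w : ℕ → EuclideanSpace ℝ (Fin d)) : Prop :=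
  ∀ t : ℕ, 1 ≤ t → w t ∈ W ∧ IsMinOn (ftalObjective loss' lam eps z w t) W (w t)

/-- The averaged predictor `ŵ_n = (1/n) ∑_{t=1}^n w(t)`. -/
def avgPredictor {d : ℕ} (w : ℕ → EuclideanSpace ℝ (Fin d)) (n : ℕ) :
    EuclideanSpace ℝ (Fin d) :=
  (n : ℝ)⁻¹ • ∑ t ∈ Finset.Icc 1 n, w t

end LinearPrediction

end

/-! Pathwise part. With c_i = ℓ'(y_i, ⟨x_i, w(i)⟩), the objective at time t is affine plus λ/2 times
`regForm x t`, so its minimizer over W has quadratic growth in that form (`leaderObjective_growth`).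
A be-the-leader induction gives regret λ/2 ‖w*‖² + (2G²/λ) ∑ β_t, where β_t is the squared dual norm
of x_t (`leader_regret`), and ∑ β_t ≤ d log(B²n + 1) by telescoping log-determinants
(`exists_elliptical_potential`). The same growth makes the iterates stable: along x_{t+τ}, the gaps
between w(t) and w(t+τ) sum to at most 6τ(G/λ) ∑ β_t (`leader_stability`). Hence w(t), tested on the
sample τ steps later, still has logarithmic regret (`IsFTAL.sum_excessLoss_le`).

Probabilistic part. Let Δ_t be the excess risk of w(t) and h_t its excess loss on sample t+τ. As
w(t) is F_t-measurable, mixing gives E[h_t | F_t] ≥ Δ_t - κ with κ = (2G²/λ) φ(τ)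
(`integral_mul_excessLoss_nonneg`). Strong convexity and λ_min(Cov) > 0 give h_t² ≤ c Δ_t
(`sq_excessLoss_le`). So exponentials of suitable increments are supermartingales along each residue
class mod τ, and with probability 1 - δ, ∑ Δ_t ≤ 2 ∑ h_t + 2Nκ + 2τ log(1/δ)(2c + 2G²/λ)
(`measureReal_sum_gt_le`). Convexity of the risk passes to the averaged predictor.

Uniformity in τ is free: the excess risk does not involve τ and the bound is deterministic, so the
fixed-lag result at the τ ≤ n minimizing the bound covers all τ ≤ n. For τ ≥ n the bound is trivial,
since no excess risk exceeds 2G²/λ. -/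

noncomputable section

namespace LinearPrediction

/-! ### Elliptical potential: determinants of regularized Gram matrices. -/

section EllipticalPotential

open Matrix

variable {d : ℕ}

/-- The regularized Gram matrix `1 + ∑_{1 ≤ i ≤ t} x_i x_iᵀ`. -/
def regGram (x : ℕ → EuclideanSpace ℝ (Fin d)) (t : ℕ) : Matrix (Fin d) (Fin d) ℝ :=
  1 + ∑ i ∈ Finset.Icc 1 t, vecMulVec (x i).ofLp (x i).ofLp

/-- The quadratic form `‖u‖² + ∑_{1 ≤ i ≤ t} ⟨x_i, u⟩²`. -/
def regForm {E : Type*} [NormedAddCommGroup E] [InnerProductSpace ℝ E] (x : ℕ → E) (t : ℕ)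
    (u : E) : ℝ :=
  ‖u‖ ^ 2 + ∑ i ∈ Finset.Icc 1 t, (inner ℝ (x i) u) ^ 2

lemma dotProduct_ofLp (x u : EuclideanSpace ℝ (Fin d)) : x.ofLp ⬝ᵥ u.ofLp = inner ℝ x u := by
  rw [EuclideanSpace.inner_eq_star_dotProduct, star_trivial, dotProduct_comm]

lemma dotProduct_regGram_mulVec (x : ℕ → EuclideanSpace ℝ (Fin d)) (t : ℕ)
    (u : EuclideanSpace ℝ (Fin d)) :
    u.ofLp ⬝ᵥ (regGram x t *ᵥ u.ofLp) = regForm x t u := by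
  rw [regGram, add_mulVec, one_mulVec, dotProduct_add, dotProduct_ofLp, real_inner_self_eq_norm_sq,
    regForm, sum_mulVec, dotProduct_sum]
  congr 1
  refine Finset.sum_congr rfl fun i _ => ?_
  rw [vecMulVec_mulVec, op_smul_eq_smul, dotProduct_smul, dotProduct_ofLp, dotProduct_ofLp,
    real_inner_comm, smul_eq_mul, sq]

lemma regForm_nonneg {E : Type*} [NormedAddCommGroup E] [InnerProductSpace ℝ E] (x : ℕ → E)
    (t : ℕ) (u : E) : 0 ≤ regForm x t u := by
  unfold regForm; positivity

lemma posDef_regGram (x : ℕ → EuclideanSpace ℝ (Fin d)) (t : ℕ) : (regGram x t).PosDef := by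
  refine PosDef.add_posSemidef PosDef.one (posSemidef_sum _ fun i _ => ?_)
  simpa using posSemidef_vecMulVec_self_star (R := ℝ) (x i).ofLp

/-- Cauchy–Schwarz between the norm of A and its dual. The form of A at u - s A⁻¹x is a nonnegative
quadratic in s, so its discriminant is at most 0. -/
lemma sq_dotProduct_le_of_posDef {A : Matrix (Fin d) (Fin d) ℝ} (hA : A.PosDef)
    (x u : Fin d → ℝ) : (x ⬝ᵥ u) ^ 2 ≤ (x ⬝ᵥ (A⁻¹ *ᵥ x)) * (u ⬝ᵥ (A *ᵥ u)) := by
  have hdet : IsUnit A.det := hA.det_pos.ne'.isUnit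
  set y := A⁻¹ *ᵥ x with hy
  have hAy : A *ᵥ y = x := by rw [hy, mulVec_mulVec, mul_nonsing_inv _ hdet, one_mulVec]
  have hsym : y ⬝ᵥ (A *ᵥ u) = x ⬝ᵥ u := by
    have hAt : Aᵀ = A := by simpa using hA.isHermitian.eq
    rw [dotProduct_mulVec, ← mulVec_transpose, hAt, hAy]
  have hq : ∀ s : ℝ, 0 ≤ (x ⬝ᵥ y) * (s * s) + (-2 * (x ⬝ᵥ u)) * s + u ⬝ᵥ (A *ᵥ u) := by
    intro s
    have h := hA.posSemidef.dotProduct_mulVec_nonneg (u - s • y)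
    have e : star (u - s • y) ⬝ᵥ (A *ᵥ (u - s • y))
        = (x ⬝ᵥ y) * (s * s) + (-2 * (x ⬝ᵥ u)) * s + u ⬝ᵥ (A *ᵥ u) := by
      rw [star_trivial, mulVec_sub, mulVec_smul, hAy, sub_dotProduct, dotProduct_sub,
        dotProduct_sub, smul_dotProduct, smul_dotProduct, hsym, dotProduct_smul, dotProduct_smul,
        dotProduct_comm u x, dotProduct_comm y x]
      simp only [smul_eq_mul]; ring
    rwa [e] at h
  have hd := discrim_le_zero hq
  rw [discrim] at hd
  nlinarith

/-- Matrix determinant lemma for a rank-one downdate, obtained from the update by -x and x. -/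
lemma det_sub_vecMulVec {A : Matrix (Fin d) (Fin d) ℝ} (hA : IsUnit A.det) (x : Fin d → ℝ) :
    (A - vecMulVec x x).det = A.det * (1 - x ⬝ᵥ (A⁻¹ *ᵥ x)) := by
  have h := det_add_replicateCol_mul_replicateRow (ι := Unit) hA (-x) x
  have e : replicateCol Unit (-x) * replicateRow Unit x = - vecMulVec x x := by
    ext i j; simp [mul_apply, vecMulVec_apply]
  rw [e, ← sub_eq_add_neg] at h
  rw [h, det_unique (n := Unit), Matrix.add_apply, one_apply_eq]
  congr 1
  rw [Matrix.mul_assoc, sub_eq_add_neg, ← dotProduct_neg, ← mulVec_neg]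
  rfl

lemma det_le_pow_of_posDef {A : Matrix (Fin d) (Fin d) ℝ} (hA : A.PosDef) {C : ℝ}
    (hC : ∀ u : EuclideanSpace ℝ (Fin d), u.ofLp ⬝ᵥ (A *ᵥ u.ofLp) ≤ C * ‖u‖ ^ 2) :
    A.det ≤ C ^ d := by
  rw [hA.isHermitian.det_eq_prod_eigenvalues]
  calc ∏ i, (hA.isHermitian.eigenvalues i : ℝ) ≤ ∏ _i : Fin d, C := by
        refine Finset.prod_le_prod (fun i _ => (hA.eigenvalues_pos i).le) fun i _ => ?_
        rw [hA.isHermitian.eigenvalues_eq i]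
        have h := hC (hA.isHermitian.eigenvectorBasis i)
        rw [(hA.isHermitian.eigenvectorBasis).orthonormal.1 i] at h
        simpa using h
    _ = C ^ d := by simp

lemma regGram_succ (x : ℕ → EuclideanSpace ℝ (Fin d)) (t : ℕ) :
    regGram x t = regGram x (t + 1) - vecMulVec (x (t + 1)).ofLp (x (t + 1)).ofLp := by
  rw [regGram, regGram, Finset.sum_Icc_succ_top (by omega), ← add_assoc, add_sub_cancel_right]

/-- **Elliptical potential lemma**: the squared norms of the vectors `x_t`, each measured in the
norm dual to `1 + ∑_{i ≤ t} x_i x_iᵀ`, have a logarithmic sum. -/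
theorem exists_elliptical_potential (x : ℕ → EuclideanSpace ℝ (Fin d)) {B : ℝ} {n : ℕ}
    (hx : ∀ i ∈ Finset.Icc 1 n, ‖x i‖ ≤ B) :
    ∃ β : ℕ → ℝ, (∀ t, 0 ≤ β t) ∧
      (∀ t, 1 ≤ t → ∀ u, (inner ℝ (x t) u) ^ 2 ≤ β t * regForm x t u) ∧
      ∑ t ∈ Finset.Icc 1 n, β t ≤ d * Real.log (B ^ 2 * n + 1) := by
  let β : ℕ → ℝ := fun t => (x t).ofLp ⬝ᵥ ((regGram x t)⁻¹ *ᵥ (x t).ofLp)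
  have hdet : ∀ t, 0 < (regGram x t).det := fun t => (posDef_regGram x t).det_pos
  refine ⟨β, fun t => ?_, fun t _ u => ?_, ?_⟩
  · simpa using (posDef_regGram x t).inv.posSemidef.dotProduct_mulVec_nonneg (x t).ofLp
  · have h := sq_dotProduct_le_of_posDef (posDef_regGram x t) (x t).ofLp u.ofLp
    rwa [dotProduct_ofLp, dotProduct_regGram_mulVec] at h
  -- det A_t = det A_{t+1} (1 - β_{t+1}), and log(1 - β) ≤ -β; positivity of both determinants
  -- forces β_{t+1} < 1.
  · have hstep : ∀ t, β (t + 1) ≤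
        Real.log (regGram x (t + 1)).det - Real.log (regGram x t).det := by
      intro t
      have h := det_sub_vecMulVec (hdet (t + 1)).ne'.isUnit (x (t + 1)).ofLp
      rw [← regGram_succ] at h
      have hpos : 0 < 1 - β (t + 1) := by
        have := hdet t
        rw [h] at this
        exact (mul_pos_iff_of_pos_left (hdet (t + 1))).1 this
      rw [h, Real.log_mul (hdet (t + 1)).ne' hpos.ne']
      have := Real.log_le_sub_one_of_pos hpos
      linarith
    have htel : ∀ m, ∑ t ∈ Finset.Icc 1 m, β t ≤ Real.log (regGram x m).det := by
      intro m
      induction m with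
      | zero => simp [regGram]
      | succ m ih =>
        rw [Finset.sum_Icc_succ_top (by omega)]
        linarith [hstep m]
    refine (htel n).trans ?_
    -- Every eigenvalue is at most 1 + nB², by evaluating the quadratic form at unit eigenvectors.
    have hle : (regGram x n).det ≤ (B ^ 2 * n + 1) ^ d := by
      refine det_le_pow_of_posDef (posDef_regGram x n) fun u => ?_
      rw [dotProduct_regGram_mulVec, regForm]
      have : ∑ i ∈ Finset.Icc 1 n, (inner ℝ (x i) u) ^ 2 ≤ ∑ _i ∈ Finset.Icc 1 n,
          B ^ 2 * ‖u‖ ^ 2 := by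
        refine Finset.sum_le_sum fun i hi => ?_
        rw [← mul_pow, ← sq_abs]
        have h1 := abs_real_inner_le_norm (x i) u
        have h2 := mul_le_mul_of_nonneg_right (hx i hi) (norm_nonneg u)
        exact pow_le_pow_left₀ (abs_nonneg _) (h1.trans h2) 2
      rw [Finset.sum_const, Nat.card_Icc, nsmul_eq_mul] at this
      push_cast [Nat.add_sub_cancel] at this
      linarith
    calc Real.log (regGram x n).det ≤ Real.log ((B ^ 2 * n + 1) ^ d) :=
          Real.log_le_log (hdet n) hle
      _ = d * Real.log (B ^ 2 * n + 1) := Real.log_pow _ _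

end EllipticalPotential

/-! ### Deterministic regret and stability of the leader. -/

section Deterministic

/-- Dividing by s and letting s → 0 gives the claim. It yields quadratic growth at a constrained
minimizer from strong convexity along segments, with no derivatives. -/
lemma add_le_of_forall_convexComb {a b κ : ℝ}
    (h : ∀ s : ℝ, 0 < s → s < 1 → a ≤ (1 - s) * a + s * b - s * (1 - s) * κ) : a + κ ≤ b := by
  by_contra! hlt
  have key : ∀ s : ℝ, 0 < s → s < 1 → (1 - s) * κ ≤ b - a := by
    intro s h0 h1
    have := h s h0 h1
    have h2 : s * ((1 - s) * κ) ≤ s * (b - a) := by linarith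
    exact le_of_mul_le_mul_left h2 h0
  have h1 := key (1 / 2) (by norm_num) (by norm_num)
  have hκ : 0 < κ := by linarith
  -- This s makes (1 - s)κ the midpoint of κ and b - a, which exceeds b - a.
  have hs := key ((κ - (b - a)) / (2 * κ)) (by apply div_pos <;> linarith)
    (by rw [div_lt_one (by linarith)]; linarith)
  have e : (1 - (κ - (b - a)) / (2 * κ)) * κ = (κ + (b - a)) / 2 := by field_simp; ring
  rw [e] at hs
  linarith

variable {E : Type*} [NormedAddCommGroup E] [InnerProductSpace ℝ E]

/-- The surrogate loss accumulated before time `t`, with the regularizer `lam / 2 ‖v‖²`. -/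
def cumLoss (lam : ℝ) (x w : ℕ → E) (c : ℕ → ℝ) (t : ℕ) (v : E) : ℝ :=
  ∑ i ∈ Finset.Ico 1 t, (c i * inner ℝ (x i) v + lam / 2 * (inner ℝ (x i) (w i - v)) ^ 2)
    + lam / 2 * ‖v‖ ^ 2

/-- The follow-the-approximate-leader objective for gradients `c_i x_i`. -/
def leaderObjective (lam : ℝ) (x w : ℕ → E) (c : ℕ → ℝ) (t : ℕ) (v : E) : ℝ :=
  cumLoss lam x w c t v + lam / 2 * (inner ℝ (x t) v) ^ 2

/-- The curvature ⟨x_t, v⟩² of round t is already in the objective at time t, so passing to the next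
cumulative loss adds only an affine function of v. This is what the extra term x_t x_tᵀ buys. -/
lemma cumLoss_succ (lam : ℝ) (x w : ℕ → E) (c : ℕ → ℝ) {t : ℕ} (ht : 1 ≤ t) (v : E) :
    cumLoss lam x w c (t + 1) v = leaderObjective lam x w c t v
      + (c t - lam * inner ℝ (x t) (w t)) * inner ℝ (x t) v
      + lam / 2 * (inner ℝ (x t) (w t)) ^ 2 := by
  rw [leaderObjective, cumLoss, cumLoss, Finset.sum_Ico_succ_top ht, inner_sub_right]
  ring

/-- Isolates all the curvature in `regForm x t`; the rest is affine in v. -/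
lemma leaderObjective_eq_regForm (lam : ℝ) (x w : ℕ → E) (c : ℕ → ℝ) {t : ℕ} (ht : 1 ≤ t)
    (v : E) : leaderObjective lam x w c t v =
      ∑ i ∈ Finset.Ico 1 t, ((c i - lam * inner ℝ (x i) (w i)) * inner ℝ (x i) v
        + lam / 2 * (inner ℝ (x i) (w i)) ^ 2) + lam / 2 * regForm x t v := by
  rw [leaderObjective, cumLoss, regForm, ← Finset.Ico_add_one_right_eq_Icc, Finset.sum_Ico_succ_top ht]
  have : ∀ i, c i * inner ℝ (x i) v + lam / 2 * (inner ℝ (x i) (w i - v)) ^ 2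
      = ((c i - lam * inner ℝ (x i) (w i)) * inner ℝ (x i) v
        + lam / 2 * (inner ℝ (x i) (w i)) ^ 2) + lam / 2 * (inner ℝ (x i) v) ^ 2 := by
    intro i; rw [inner_sub_right]; ring
  simp_rw [this]
  rw [Finset.sum_add_distrib, ← Finset.mul_sum]
  ring

lemma regForm_convexComb (x : ℕ → E) (t : ℕ) (u v : E) (s : ℝ) :
    regForm x t ((1 - s) • u + s • v) =
      (1 - s) * regForm x t u + s * regForm x t v - s * (1 - s) * regForm x t (v - u) := by
  have h1 : ‖(1 - s) • u + s • v‖ ^ 2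
      = (1 - s) * ‖u‖ ^ 2 + s * ‖v‖ ^ 2 - s * (1 - s) * ‖v - u‖ ^ 2 := by
    simp only [← real_inner_self_eq_norm_sq, inner_add_left, inner_add_right, inner_sub_left,
      inner_sub_right, real_inner_smul_left, real_inner_smul_right, real_inner_comm v u]
    ring
  simp only [regForm]
  rw [h1, mul_add, mul_add, mul_add, Finset.mul_sum, Finset.mul_sum, Finset.mul_sum]
  have h2 : ∑ i ∈ Finset.Icc 1 t, (inner ℝ (x i) ((1 - s) • u + s • v)) ^ 2
      = ∑ i ∈ Finset.Icc 1 t, (1 - s) * (inner ℝ (x i) u) ^ 2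
        + ∑ i ∈ Finset.Icc 1 t, s * (inner ℝ (x i) v) ^ 2
        - ∑ i ∈ Finset.Icc 1 t, s * (1 - s) * (inner ℝ (x i) (v - u)) ^ 2 := by
    rw [← Finset.sum_add_distrib, ← Finset.sum_sub_distrib]
    refine Finset.sum_congr rfl fun i _ => ?_
    rw [inner_add_right, inner_sub_right, real_inner_smul_right, real_inner_smul_right]
    ring
  rw [h2]; ring

lemma leaderObjective_convexComb (lam : ℝ) (x w : ℕ → E) (c : ℕ → ℝ) {t : ℕ} (ht : 1 ≤ t)
    (u v : E) (s : ℝ) :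
    leaderObjective lam x w c t ((1 - s) • u + s • v) =
      (1 - s) * leaderObjective lam x w c t u + s * leaderObjective lam x w c t v
        - s * (1 - s) * (lam / 2 * regForm x t (v - u)) := by
  simp only [leaderObjective_eq_regForm lam x w c ht, regForm_convexComb]
  have h2 : ∑ i ∈ Finset.Ico 1 t, ((c i - lam * inner ℝ (x i) (w i))
        * inner ℝ (x i) ((1 - s) • u + s • v) + lam / 2 * (inner ℝ (x i) (w i)) ^ 2)
      = (1 - s) * ∑ i ∈ Finset.Ico 1 t, ((c i - lam * inner ℝ (x i) (w i))
        * inner ℝ (x i) u + lam / 2 * (inner ℝ (x i) (w i)) ^ 2)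
      + s * ∑ i ∈ Finset.Ico 1 t, ((c i - lam * inner ℝ (x i) (w i))
        * inner ℝ (x i) v + lam / 2 * (inner ℝ (x i) (w i)) ^ 2) := by
    rw [Finset.mul_sum, Finset.mul_sum, ← Finset.sum_add_distrib]
    refine Finset.sum_congr rfl fun i _ => ?_
    rw [inner_add_right, real_inner_smul_right, real_inner_smul_right]
    ring
  rw [h2]; ring

lemma leaderObjective_growth {lam : ℝ} {x w : ℕ → E} {c : ℕ → ℝ} {W : Set E}
    (hW : Convex ℝ W) {t : ℕ} (ht : 1 ≤ t) {u v : E} (hu : u ∈ W) (hv : v ∈ W)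
    (hmin : IsMinOn (leaderObjective lam x w c t) W u) :
    leaderObjective lam x w c t u + lam / 2 * regForm x t (v - u) ≤
      leaderObjective lam x w c t v := by
  refine add_le_of_forall_convexComb fun s h0 h1 => ?_
  rw [← leaderObjective_convexComb lam x w c ht]
  exact hmin (hW hu hv (by linarith) h0.le (by ring))

lemma regForm_mono (x : ℕ → E) {i s : ℕ} (h : i ≤ s) (u : E) : regForm x i u ≤ regForm x s u := by
  unfold regForm
  gcongr

/-- Weighted arithmetic–geometric mean inequality; the weights are chosen so that λ/2 · r matches
the growth of the objective. -/
lemma abs_mul_le_of_sq_le {lam p e β r : ℝ} (hlam : 0 < lam) (hβ : 0 ≤ β) (hr : 0 ≤ r)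
    (h : e ^ 2 ≤ β * r) : |p * e| ≤ lam / 2 * r + p ^ 2 / (2 * lam) * β := by
  refine abs_le_of_sq_le_sq ?_ (by positivity)
  have h1 : (p * e) ^ 2 ≤ p ^ 2 * (β * r) := by rw [mul_pow]; gcongr
  have h2 : (lam / 2 * r + p ^ 2 / (2 * lam) * β) ^ 2
      = (lam / 2 * r - p ^ 2 / (2 * lam) * β) ^ 2 + p ^ 2 * (β * r) := by field_simp; ring
  nlinarith [sq_nonneg (lam / 2 * r - p ^ 2 / (2 * lam) * β)]

section

variable {lam G : ℝ} {x w : ℕ → E} {c β : ℕ → ℝ} {W : Set E}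
  (hlam : 0 < lam) (hW : Convex ℝ W)
  (hc : ∀ i, 1 ≤ i → |c i| ≤ G) (hxW : ∀ i, 1 ≤ i → ∀ v ∈ W, lam * |inner ℝ (x i) v| ≤ G)
  (hwW : ∀ t, 1 ≤ t → w t ∈ W)
  (hmin : ∀ t, 1 ≤ t → IsMinOn (leaderObjective lam x w c t) W (w t))
  (hβ : ∀ t, 0 ≤ β t)
  (hβx : ∀ t, 1 ≤ t → ∀ u, (inner ℝ (x t) u) ^ 2 ≤ β t * regForm x t u)

include hlam hc hxW hwW in
lemma abs_shifted_coeff_le (i : ℕ) (hi : 1 ≤ i) : |c i - lam * inner ℝ (x i) (w i)| ≤ 2 * G := by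
  have h1 := hc i hi
  have h2 := hxW i hi (w i) (hwW i hi)
  have h3 : |lam * inner ℝ (x i) (w i)| ≤ G := by rwa [abs_mul, abs_of_pos hlam]
  calc _ ≤ |c i| + |lam * inner ℝ (x i) (w i)| := abs_sub _ _
    _ ≤ 2 * G := by linarith

-- Be-the-leader induction. It runs over all v in W because the hypothesis is used at v = w(m+1).
-- The new affine term has slope at most 2G in ⟨x, v⟩; the growth around w(m+1) absorbs it up to
-- (2G)²/(2λ) β = 2G²/λ β.
include hlam hW hc hxW hwW hmin hβ hβx in
lemma sum_le_cumLoss (m : ℕ) : ∀ v ∈ W,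
    ∑ i ∈ Finset.Icc 1 m, (c i * inner ℝ (x i) (w i) - 2 * G ^ 2 / lam * β i) ≤
      cumLoss lam x w c (m + 1) v := by
  induction m with
  | zero => intro v _; simp [cumLoss]; positivity
  | succ m ih =>
    intro v hv
    have ht : 1 ≤ m + 1 := by omega
    have hg := leaderObjective_growth hW ht (hwW _ ht) hv (hmin _ ht)
    have hih := ih (w (m + 1)) (hwW _ ht)
    have hp := abs_shifted_coeff_le hlam hc hxW hwW (m + 1) ht
    rw [Finset.sum_Icc_succ_top ht, cumLoss_succ lam x w c ht]
    set p := c (m + 1) - lam * inner ℝ (x (m + 1)) (w (m + 1)) with hpdef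
    have hb := (abs_le.1 (abs_mul_le_of_sq_le (p := p) hlam (hβ (m + 1))
      (regForm_nonneg x (m + 1) (v - w (m + 1))) (hβx (m + 1) ht (v - w (m + 1))))).1
    have hp2 : p ^ 2 / (2 * lam) * β (m + 1) ≤ 2 * G ^ 2 / lam * β (m + 1) := by
      refine mul_le_mul_of_nonneg_right ?_ (hβ _)
      rw [div_le_div_iff₀ (by positivity) hlam]
      have : p ^ 2 ≤ (2 * G) ^ 2 := by
        rw [← sq_abs]; exact pow_le_pow_left₀ (abs_nonneg _) hp 2
      nlinarith
    have hid : p * inner ℝ (x (m + 1)) v = p * inner ℝ (x (m + 1)) (v - w (m + 1))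
        + p * inner ℝ (x (m + 1)) (w (m + 1)) := by rw [inner_sub_right]; ring
    have hobj : leaderObjective lam x w c (m + 1) (w (m + 1)) = cumLoss lam x w c (m + 1)
      (w (m + 1)) + lam / 2 * (inner ℝ (x (m + 1)) (w (m + 1))) ^ 2 := rfl
    have hpp : p * inner ℝ (x (m + 1)) (w (m + 1)) = c (m + 1) * inner ℝ (x (m + 1)) (w (m + 1))
        - lam * (inner ℝ (x (m + 1)) (w (m + 1))) ^ 2 := by rw [hpdef]; ring
    linarith

include hlam hW hc hxW hwW hmin hβ hβx in
/-- The regret of the modified follow-the-approximate-leader algorithm. -/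
theorem leader_regret (n : ℕ) {v : E} (hv : v ∈ W) :
    ∑ i ∈ Finset.Icc 1 n,
        (c i * inner ℝ (x i) (w i - v) - lam / 2 * (inner ℝ (x i) (w i - v)) ^ 2) ≤
      lam / 2 * ‖v‖ ^ 2 + 2 * G ^ 2 / lam * ∑ i ∈ Finset.Icc 1 n, β i := by
  have h := sum_le_cumLoss hlam hW hc hxW hwW hmin hβ hβx n v hv
  rw [cumLoss, Finset.Ico_add_one_right_eq_Icc, Finset.sum_sub_distrib, ← Finset.mul_sum] at h
  have e : ∑ i ∈ Finset.Icc 1 n,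
        (c i * inner ℝ (x i) (w i - v) - lam / 2 * (inner ℝ (x i) (w i - v)) ^ 2)
      = ∑ i ∈ Finset.Icc 1 n, c i * inner ℝ (x i) (w i) - ∑ i ∈ Finset.Icc 1 n,
        (c i * inner ℝ (x i) v + lam / 2 * (inner ℝ (x i) (w i - v)) ^ 2) := by
    rw [← Finset.sum_sub_distrib]
    refine Finset.sum_congr rfl fun i _ => ?_
    rw [inner_sub_right]; ring
  rw [e]; linarith

-- Adding the growth inequalities at times t and s leaves only the change of objective between these
-- times: affine terms for t ≤ i < s, of slope at most 2G, and squares for t < i ≤ s, of slope at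
-- most G on W. The growth at time t is discarded.
include hlam hW hc hxW hwW hmin in
lemma regForm_sub_le {t s : ℕ} (ht : 1 ≤ t) (hts : t ≤ s) :
    lam / 2 * regForm x s (w t - w s) ≤
      2 * G * ∑ i ∈ Finset.Ico t s, |inner ℝ (x i) (w t - w s)|
        + G * ∑ i ∈ Finset.Ioc t s, |inner ℝ (x i) (w t - w s)| := by
  have hs : 1 ≤ s := ht.trans hts
  have h1 := leaderObjective_growth hW hs (hwW s hs) (hwW t ht) (hmin s hs)
  have h2 := leaderObjective_growth hW ht (hwW t ht) (hwW s hs) (hmin t ht)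
  have h3 := regForm_nonneg x t (w s - w t)
  have hreg : ∀ v, regForm x s v
      = regForm x t v + ∑ i ∈ Finset.Ioc t s, (inner ℝ (x i) v) ^ 2 := by
    intro v
    rw [regForm, regForm, add_assoc]
    congr 1
    exact (Finset.sum_Ioc_consecutive (fun i => (inner ℝ (x i) v) ^ 2) (Nat.zero_le t) hts).symm
  have hd : ∀ v, leaderObjective lam x w c s v = leaderObjective lam x w c t v
      + ∑ i ∈ Finset.Ico t s, ((c i - lam * inner ℝ (x i) (w i)) * inner ℝ (x i) v
        + lam / 2 * (inner ℝ (x i) (w i)) ^ 2)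
      + lam / 2 * ∑ i ∈ Finset.Ioc t s, (inner ℝ (x i) v) ^ 2 := by
    intro v
    rw [leaderObjective_eq_regForm lam x w c hs, leaderObjective_eq_regForm lam x w c ht, hreg,
      ← Finset.sum_Ico_consecutive _ ht hts]
    ring
  rw [hd (w t), hd (w s)] at h1
  have hA : ∑ i ∈ Finset.Ico t s, ((c i - lam * inner ℝ (x i) (w i)) * inner ℝ (x i) (w t)
        + lam / 2 * (inner ℝ (x i) (w i)) ^ 2)
      - ∑ i ∈ Finset.Ico t s, ((c i - lam * inner ℝ (x i) (w i)) * inner ℝ (x i) (w s)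
        + lam / 2 * (inner ℝ (x i) (w i)) ^ 2)
      ≤ 2 * G * ∑ i ∈ Finset.Ico t s, |inner ℝ (x i) (w t - w s)| := by
    rw [← Finset.sum_sub_distrib, Finset.mul_sum]
    refine Finset.sum_le_sum fun i hi => ?_
    have hi1 : 1 ≤ i := ht.trans (Finset.mem_Ico.1 hi).1
    have hp := abs_shifted_coeff_le hlam hc hxW hwW i hi1
    calc _ = (c i - lam * inner ℝ (x i) (w i)) * inner ℝ (x i) (w t - w s) := by
          rw [inner_sub_right]; ring
      _ ≤ |c i - lam * inner ℝ (x i) (w i)| * |inner ℝ (x i) (w t - w s)| := by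
          rw [← abs_mul]; exact le_abs_self _
      _ ≤ _ := by gcongr
  have hB : lam / 2 * ∑ i ∈ Finset.Ioc t s, (inner ℝ (x i) (w t)) ^ 2
      - lam / 2 * ∑ i ∈ Finset.Ioc t s, (inner ℝ (x i) (w s)) ^ 2
      ≤ G * ∑ i ∈ Finset.Ioc t s, |inner ℝ (x i) (w t - w s)| := by
    rw [← mul_sub, ← Finset.sum_sub_distrib, Finset.mul_sum, Finset.mul_sum]
    refine Finset.sum_le_sum fun i hi => ?_
    have hi1 : 1 ≤ i := ht.trans (Finset.mem_Ioc.1 hi).1.le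
    have ha := hxW i hi1 (w t) (hwW t ht)
    have hb := hxW i hi1 (w s) (hwW s hs)
    calc _ = lam / 2 * (inner ℝ (x i) (w t) + inner ℝ (x i) (w s))
            * inner ℝ (x i) (w t - w s) := by rw [inner_sub_right]; ring
      _ ≤ |lam / 2 * (inner ℝ (x i) (w t) + inner ℝ (x i) (w s))|
            * |inner ℝ (x i) (w t - w s)| := by rw [← abs_mul]; exact le_abs_self _
      _ ≤ _ := by
          gcongr
          rw [abs_mul, abs_of_pos (by positivity : 0 < lam / 2)]
          have := abs_add_le (inner ℝ (x i) (w t)) (inner ℝ (x i) (w s))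
          nlinarith
  have h4 : 0 ≤ lam / 2 * regForm x t (w s - w t) := by positivity
  linarith

-- With ρ² the form at time s, every i ≤ s satisfies |⟨x_i, u⟩| ≤ √β_i ρ. Dividing `regForm_sub_le`
-- by ρ bounds ρ itself, and 2√β_i √β_s ≤ β_i + β_s turns the outcome into sums of β.
include hlam hW hc hxW hwW hmin hβ hβx in
lemma abs_inner_sub_le {t s : ℕ} (ht : 1 ≤ t) (hts : t ≤ s) :
    lam * |inner ℝ (x s) (w t - w s)| ≤
      G * (2 * ∑ i ∈ Finset.Ico t s, (β i + β s) + ∑ i ∈ Finset.Ioc t s, (β i + β s)) := by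
  have hs : 1 ≤ s := ht.trans hts
  have hG : 0 ≤ G := (abs_nonneg _).trans (hc 1 le_rfl)
  have hmain := regForm_sub_le hlam hW hc hxW hwW hmin ht hts
  set u := w t - w s
  set ρ := √(regForm x s u) with hρ
  have hρ0 : 0 ≤ ρ := Real.sqrt_nonneg _
  have hρ2 : ρ * ρ = regForm x s u := Real.mul_self_sqrt (regForm_nonneg x s u)
  have hi : ∀ i, 1 ≤ i → i ≤ s → |inner ℝ (x i) u| ≤ √(β i) * ρ := by
    intro i h1 h2
    rw [hρ, ← Real.sqrt_mul (hβ i), ← Real.sqrt_sq_eq_abs]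
    exact Real.sqrt_le_sqrt ((hβx i h1 u).trans
      (mul_le_mul_of_nonneg_left (regForm_mono x h2 u) (hβ i)))
  have hsum1 : ∑ i ∈ Finset.Ico t s, |inner ℝ (x i) u| ≤ (∑ i ∈ Finset.Ico t s, √(β i)) * ρ := by
    rw [Finset.sum_mul]
    refine Finset.sum_le_sum fun i h => ?_
    have := Finset.mem_Ico.1 h
    exact hi i (by omega) (by omega)
  have hsum2 : ∑ i ∈ Finset.Ioc t s, |inner ℝ (x i) u| ≤ (∑ i ∈ Finset.Ioc t s, √(β i)) * ρ := by
    rw [Finset.sum_mul]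
    refine Finset.sum_le_sum fun i h => ?_
    have := Finset.mem_Ioc.1 h
    exact hi i (by omega) (by omega)
  have hS0 : 0 ≤ G * (2 * ∑ i ∈ Finset.Ico t s, √(β i) + ∑ i ∈ Finset.Ioc t s, √(β i)) := by
    positivity
  have hρle : lam / 2 * ρ ≤
      G * (2 * ∑ i ∈ Finset.Ico t s, √(β i) + ∑ i ∈ Finset.Ioc t s, √(β i)) := by
    rcases hρ0.eq_or_lt with h0 | h0
    · rw [← h0, mul_zero]; exact hS0
    · refine le_of_mul_le_mul_right ?_ h0
      have h1 := mul_le_mul_of_nonneg_left hsum1 (by positivity : 0 ≤ 2 * G)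
      have h2 := mul_le_mul_of_nonneg_left hsum2 hG
      rw [← hρ2] at hmain
      linarith
  have hpair : ∀ S : Finset ℕ, 2 * ((∑ i ∈ S, √(β i)) * √(β s)) ≤ ∑ i ∈ S, (β i + β s) := by
    intro S
    rw [Finset.sum_mul, Finset.mul_sum]
    refine Finset.sum_le_sum fun i _ => ?_
    nlinarith [sq_nonneg (√(β i) - √(β s)), Real.sq_sqrt (hβ i), Real.sq_sqrt (hβ s)]
  have h5 := hi s hs le_rfl
  have h6 := mul_le_mul_of_nonneg_right hρle (Real.sqrt_nonneg (β s))
  calc lam * |inner ℝ (x s) u| ≤ lam * (√(β s) * ρ) := by gcongr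
    _ ≤ G * (2 * (2 * ((∑ i ∈ Finset.Ico t s, √(β i)) * √(β s)))
        + 2 * ((∑ i ∈ Finset.Ioc t s, √(β i)) * √(β s))) := by linarith
    _ ≤ _ := by
        gcongr
        · exact hpair _
        · exact hpair _

include hlam hW hc hxW hwW hmin hβ hβx in
/-- Stability of the iterates of the modified follow-the-approximate-leader algorithm. -/
theorem leader_stability {n τ : ℕ} (hτ : τ ≤ n) :
    lam * ∑ t ∈ Finset.Icc 1 (n - τ), |inner ℝ (x (t + τ)) (w t - w (t + τ))| ≤
      6 * τ * G * ∑ t ∈ Finset.Icc 1 n, β t := by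
  have hG : 0 ≤ G := (abs_nonneg _).trans (hc 1 le_rfl)
  set Q := ∑ t ∈ Finset.Icc 1 n, β t
  -- All shifted sums are subsums of Q, as t + k ≤ n when t ≤ n - τ and k ≤ τ.
  have hshift : ∀ k ≤ τ, ∑ t ∈ Finset.Icc 1 (n - τ), β (t + k) ≤ Q := by
    intro k hk
    rw [← Finset.sum_image (f := β) (g := fun t => t + k) (fun a _ b _ h => Nat.add_right_cancel h)]
    refine Finset.sum_le_sum_of_subset_of_nonneg ?_ fun i _ _ => hβ i
    intro i hi
    simp only [Finset.mem_image, Finset.mem_Icc] at hi ⊢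
    omega
  have hterm : ∀ t ∈ Finset.Icc 1 (n - τ), lam * |inner ℝ (x (t + τ)) (w t - w (t + τ))| ≤
      G * (2 * ∑ k ∈ Finset.range τ, (β (t + k) + β (t + τ))
        + ∑ k ∈ Finset.range τ, (β (t + (k + 1)) + β (t + τ))) := by
    intro t ht
    have h := abs_inner_sub_le hlam hW hc hxW hwW hmin hβ hβx (Finset.mem_Icc.1 ht).1
      (Nat.le_add_right t τ)
    rw [← Finset.Ico_add_one_add_one_eq_Ioc, Finset.sum_Ico_eq_sum_range,
      Finset.sum_Ico_eq_sum_range, add_tsub_add_eq_tsub_right, Nat.add_sub_cancel_left] at h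
    simpa only [add_assoc, add_comm 1] using h
  rw [Finset.mul_sum]
  refine (Finset.sum_le_sum hterm).trans ?_
  rw [← Finset.mul_sum, Finset.sum_add_distrib, ← Finset.mul_sum, Finset.sum_comm,
    Finset.sum_comm (s := Finset.Icc 1 (n - τ))]
  have hb1 : ∑ k ∈ Finset.range τ, ∑ t ∈ Finset.Icc 1 (n - τ), (β (t + k) + β (t + τ))
      ≤ ∑ _k ∈ Finset.range τ, 2 * Q := by
    refine Finset.sum_le_sum fun k hk => ?_
    have := Finset.mem_range.1 hk
    rw [Finset.sum_add_distrib]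
    linarith [hshift k (by omega), hshift τ le_rfl]
  have hb2 : ∑ k ∈ Finset.range τ, ∑ t ∈ Finset.Icc 1 (n - τ), (β (t + (k + 1)) + β (t + τ))
      ≤ ∑ _k ∈ Finset.range τ, 2 * Q := by
    refine Finset.sum_le_sum fun k hk => ?_
    have := Finset.mem_range.1 hk
    rw [Finset.sum_add_distrib]
    linarith [hshift (k + 1) (by omega), hshift τ le_rfl]
  rw [Finset.sum_const, Finset.card_range, nsmul_eq_mul] at hb1 hb2
  -- The 6 is (2 + 1) · 2: weights 2 and 1 from the two kinds of terms, each summand β_i + β_s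
  -- costing 2Q.
  calc _ ≤ G * (2 * (τ * (2 * Q)) + τ * (2 * Q)) := by gcongr
    _ = _ := by ring

end

end Deterministic

/-! ### Consequences of strong convexity and the Lipschitz property for the scalar loss. -/

section Loss

variable {Y : Type*} {loss loss' : Y → ℝ → ℝ} {lam G r : ℝ}

lemma LinearStrongConvexity.abs_subgradient_le (h : LinearStrongConvexity loss loss' lam G r)
    (hlam : 0 < lam) (y : Y) {a : ℝ} (ha : |a| ≤ r) : |loss' y a| ≤ G := by
  rcases ha.eq_or_lt with he | hlt
  · exact h.endpoint_bound y a he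
  -- Comparing with a ± η, both still in [-r, r], bounds the slope on either side.
  · set η := r - |a| with hη
    have hη0 : 0 < η := by linarith
    have hp : |a + η| ≤ r := (abs_add_le a η).trans (by rw [abs_of_pos hη0]; linarith)
    have hm : |a - η| ≤ r := (abs_sub a η).trans (by rw [abs_of_pos hη0]; linarith)
    have h1 := h.strong_convex y a (a + η) ha hp
    have h2 := h.strong_convex y a (a - η) ha hm
    have h3 := (le_abs_self _).trans (h.lipschitz y a (a + η) ha hp)
    have h4 := (le_abs_self _).trans (h.lipschitz y a (a - η) ha hm)
    rw [show a - (a + η) = -η by ring, abs_neg, abs_of_pos hη0] at h3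
    rw [show a - (a - η) = η by ring, abs_of_pos hη0] at h4
    have hq : 0 ≤ lam / 2 * η ^ 2 := by positivity
    refine abs_le.2 ⟨?_, ?_⟩
    · refine le_of_mul_le_mul_right ?_ hη0
      have : lam / 2 * (a - η - a) ^ 2 = lam / 2 * η ^ 2 := by ring
      have : loss' y a * (a - η - a) = - (loss' y a * η) := by ring
      linarith
    · refine le_of_mul_le_mul_right ?_ hη0
      have : lam / 2 * (a + η - a) ^ 2 = lam / 2 * η ^ 2 := by ring
      have : loss' y a * (a + η - a) = loss' y a * η := by ring
      linarith

/-- Strong monotonicity: λ(b - a)² ≤ (ℓ'(b) - ℓ'(a))(b - a), while subgradients are bounded by G. So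
the interval has length at most 2G/λ, and both λRB and the oscillation of the loss are controlled by
G and λ alone. -/
lemma LinearStrongConvexity.mul_abs_sub_le (h : LinearStrongConvexity loss loss' lam G r)
    (hlam : 0 < lam) (y : Y) {a b : ℝ} (ha : |a| ≤ r) (hb : |b| ≤ r) :
    lam * |b - a| ≤ 2 * G := by
  have hG : 0 ≤ G := (abs_nonneg _).trans (h.abs_subgradient_le hlam y ha)
  rcases eq_or_ne b a with rfl | hne
  · simpa using hG
  have hpos : 0 < |b - a| := abs_pos.2 (sub_ne_zero.2 hne)
  refine le_of_mul_le_mul_right ?_ hpos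
  have h1 := h.strong_convex y a b ha hb
  have h2 := h.strong_convex y b a hb ha
  have h3 : (loss' y b - loss' y a) * (b - a) ≤ 2 * G * |b - a| := by
    calc _ ≤ |loss' y b - loss' y a| * |b - a| := by rw [← abs_mul]; exact le_abs_self _
      _ ≤ 2 * G * |b - a| := by
        gcongr
        have h4 := abs_sub (loss' y b) (loss' y a)
        linarith [h.abs_subgradient_le hlam y ha, h.abs_subgradient_le hlam y hb]
  rw [mul_assoc, ← sq, sq_abs]
  nlinarith

lemma LinearStrongConvexity.lipschitz_const_nonneg (h : LinearStrongConvexity loss loss' lam G r)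
    (hr : 0 ≤ r) (y : Y) : 0 ≤ G :=
  (abs_nonneg _).trans (h.endpoint_bound y r (abs_of_nonneg hr))

lemma LinearStrongConvexity.mul_radius_le (h : LinearStrongConvexity loss loss' lam G r)
    (hlam : 0 < lam) (hr : 0 ≤ r) (y : Y) : lam * r ≤ G := by
  have h1 := h.mul_abs_sub_le hlam y (a := -r) (b := r) (by simp [abs_of_nonneg hr])
    (by simp [abs_of_nonneg hr])
  rw [sub_neg_eq_add, abs_of_nonneg (by linarith)] at h1
  linarith

lemma LinearStrongConvexity.abs_sub_le (h : LinearStrongConvexity loss loss' lam G r)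
    (hlam : 0 < lam) (y : Y) {a b : ℝ} (ha : |a| ≤ r) (hb : |b| ≤ r) :
    |loss y b - loss y a| ≤ 2 * G ^ 2 / lam := by
  have hG : 0 ≤ G := (abs_nonneg _).trans (h.abs_subgradient_le hlam y ha)
  refine (h.lipschitz y a b ha hb).trans ?_
  rw [le_div_iff₀ hlam, abs_sub_comm]
  nlinarith [h.mul_abs_sub_le hlam y ha hb]

lemma LinearStrongConvexity.le_convexComb (h : LinearStrongConvexity loss loss' lam G r)
    (y : Y) {a b s : ℝ} (ha : |a| ≤ r) (hb : |b| ≤ r) (h0 : 0 ≤ s) (h1 : s ≤ 1) :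
    loss y ((1 - s) * a + s * b) ≤
      (1 - s) * loss y a + s * loss y b - s * (1 - s) * (lam / 2 * (b - a) ^ 2) := by
  -- The subgradient inequalities at m towards a and b are averaged; their linear terms cancel.
  set m := (1 - s) * a + s * b with hm
  have hmr : |m| ≤ r := by
    refine (abs_add_le _ _).trans ?_
    rw [abs_mul, abs_mul, abs_of_nonneg h0, abs_of_nonneg (sub_nonneg.2 h1)]
    nlinarith
  have ha' := mul_le_mul_of_nonneg_left (h.strong_convex y m a hmr ha) (sub_nonneg.2 h1)
  have hb' := mul_le_mul_of_nonneg_left (h.strong_convex y m b hmr hb) h0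
  have e1 : a - m = - (s * (b - a)) := by rw [hm]; ring
  have e2 : b - m = (1 - s) * (b - a) := by rw [hm]; ring
  rw [e1] at ha'
  rw [e2] at hb'
  nlinarith

end Loss

/-! ### The second moment matrix and its smallest eigenvalue. -/

section SecondMoment

open Matrix

/-- Subtracting λ_min · 1 shifts the spectrum, so the difference is positive semidefinite. -/
lemma lambdaMin_mul_le {d : ℕ} {M : Matrix (Fin d) (Fin d) ℝ} (hM : M.IsHermitian)
    (u : EuclideanSpace ℝ (Fin d)) :
    lambdaMin M * ‖u‖ ^ 2 ≤ u.ofLp ⬝ᵥ (M *ᵥ u.ofLp) := by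
  have hH : (M - lambdaMin M • (1 : Matrix (Fin d) (Fin d) ℝ)).IsHermitian := by
    refine hM.sub ?_
    simp [IsHermitian]
  have hpsd : (M - lambdaMin M • (1 : Matrix (Fin d) (Fin d) ℝ)).PosSemidef := by
    rw [hH.posSemidef_iff_eigenvalues_nonneg]
    intro i
    have hmem : hH.eigenvalues i ∈ spectrum ℝ (M - lambdaMin M • (1 : Matrix (Fin d) (Fin d) ℝ)) := by
      rw [hH.spectrum_real_eq_range_eigenvalues]; exact Set.mem_range_self i
    have hmem' : hH.eigenvalues i + lambdaMin M ∈ spectrum ℝ M := by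
      rw [spectrum.mem_iff] at hmem ⊢
      convert hmem using 2
      rw [map_add, Algebra.algebraMap_eq_smul_one (lambdaMin M)]; abel
    have hbdd : BddBelow (spectrum ℝ M) := by
      rw [hM.spectrum_real_eq_range_eigenvalues]
      exact (Set.finite_range _).bddBelow
    have : lambdaMin M ≤ hH.eigenvalues i + lambdaMin M := csInf_le hbdd hmem'
    simpa using this
  have h := hpsd.dotProduct_mulVec_nonneg u.ofLp
  rw [star_trivial, sub_mulVec, dotProduct_sub, smul_mulVec, one_mulVec, dotProduct_smul,
    dotProduct_ofLp u u, real_inner_self_eq_norm_sq, smul_eq_mul] at h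
  linarith

variable {d : ℕ} {Y : Type*} [MeasurableSpace Y] {Pi : Measure (EuclideanSpace ℝ (Fin d) × Y)}
  [IsProbabilityMeasure Pi] {B : ℝ}

lemma integrable_coord_mul (hB : ∀ᵐ z ∂Pi, ‖z.1‖ ≤ B) (i j : Fin d) :
    Integrable (fun z : EuclideanSpace ℝ (Fin d) × Y => z.1 i * z.1 j) Pi := by
  refine Integrable.of_bound (C := B * B) (by fun_prop) ?_
  filter_upwards [hB] with z hz
  rw [norm_mul]
  have hi := (PiLp.norm_apply_le z.1 i).trans hz
  have hj := (PiLp.norm_apply_le z.1 j).trans hz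
  exact mul_le_mul hi hj (norm_nonneg _) ((norm_nonneg _).trans hi)

lemma integral_inner_sq (hB : ∀ᵐ z ∂Pi, ‖z.1‖ ≤ B) (u : EuclideanSpace ℝ (Fin d)) :
    ∫ z, (inner ℝ z.1 u) ^ 2 ∂Pi = u.ofLp ⬝ᵥ (secondMoment Pi *ᵥ u.ofLp) := by
  have e : ∀ z : EuclideanSpace ℝ (Fin d) × Y, (inner ℝ z.1 u) ^ 2
      = ∑ i, ∑ j, u i * u j * (z.1 i * z.1 j) := by
    intro z
    rw [← dotProduct_ofLp, sq, dotProduct, Finset.sum_mul_sum]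
    refine Finset.sum_congr rfl fun i _ => Finset.sum_congr rfl fun j _ => ?_
    ring
  simp_rw [e]
  rw [integral_finsetSum _ fun i _ => integrable_finsetSum _ fun j _ =>
    (integrable_coord_mul hB i j).const_mul _]
  simp only [dotProduct, mulVec, Finset.mul_sum]
  refine Finset.sum_congr rfl fun i _ => ?_
  rw [integral_finsetSum _ fun j _ => (integrable_coord_mul hB i j).const_mul _]
  refine Finset.sum_congr rfl fun j _ => ?_
  rw [integral_const_mul, secondMoment, of_apply]
  ring

lemma lambdaMin_secondMoment_mul_le (hB : ∀ᵐ z ∂Pi, ‖z.1‖ ≤ B) (u : EuclideanSpace ℝ (Fin d)) :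
    lambdaMin (secondMoment Pi) * ‖u‖ ^ 2 ≤ ∫ z, (inner ℝ z.1 u) ^ 2 ∂Pi := by
  rw [integral_inner_sq hB]
  refine lambdaMin_mul_le ?_ u
  ext i j
  simp [secondMoment, mul_comm]

lemma integrable_inner_sq (hB : ∀ᵐ z ∂Pi, ‖z.1‖ ≤ B) (u : EuclideanSpace ℝ (Fin d)) :
    Integrable (fun z : EuclideanSpace ℝ (Fin d) × Y => (inner ℝ z.1 u) ^ 2) Pi := by
  refine Integrable.of_bound (C := (B * ‖u‖) ^ 2)
    (Measurable.aestronglyMeasurable (by fun_prop)) ?_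
  filter_upwards [hB] with z hz
  rw [norm_pow]
  gcongr
  exact (norm_inner_le_norm _ _).trans (by gcongr)

end SecondMoment

/-! ### Convexity and growth of the risk; truncated excess losses. -/

section Risk

variable {d : ℕ} {Y : Type*} [MeasurableSpace Y] {Pi : Measure (EuclideanSpace ℝ (Fin d) × Y)}
  [IsProbabilityMeasure Pi] {B R : ℝ} {W : Set (EuclideanSpace ℝ (Fin d))}
  {loss loss' : Y → ℝ → ℝ} {lam G : ℝ} {wstar : EuclideanSpace ℝ (Fin d)}

lemma abs_inner_le_of_norm_le {x w : EuclideanSpace ℝ (Fin d)} (hx : ‖x‖ ≤ B) (hw : ‖w‖ ≤ R) :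
    |inner ℝ x w| ≤ R * B := by
  refine (abs_real_inner_le_norm x w).trans ?_
  rw [mul_comm R B]
  exact mul_le_mul hx hw (norm_nonneg _) ((norm_nonneg _).trans hx)

lemma risk_convexComb_le (hB : ∀ᵐ z ∂Pi, ‖z.1‖ ≤ B) (hWconv : Convex ℝ W)
    (hWR : ∀ w ∈ W, ‖w‖ ≤ R) (hlin : LinearStrongConvexity loss loss' lam G (R * B))
    (hint : ∀ w ∈ W, Integrable (sampleLoss loss w) Pi)
    {u v : EuclideanSpace ℝ (Fin d)} (hu : u ∈ W) (hv : v ∈ W) {s : ℝ} (h0 : 0 ≤ s) (h1 : s ≤ 1) :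
    risk loss Pi ((1 - s) • u + s • v) ≤ (1 - s) * risk loss Pi u + s * risk loss Pi v
      - s * (1 - s) * (lam / 2 * ∫ z, (inner ℝ z.1 (v - u)) ^ 2 ∂Pi) := by
  have hi1 := (hint u hu).const_mul (1 - s)
  have hi2 := (hint v hv).const_mul s
  have hi3 := ((integrable_inner_sq hB (v - u)).const_mul (lam / 2)).const_mul (s * (1 - s))
  rw [risk, risk, risk, ← integral_const_mul, ← integral_const_mul, ← integral_const_mul,
    ← integral_const_mul, ← integral_add hi1 hi2, ← integral_sub (by exact hi1.add hi2) hi3]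
  refine integral_mono_ae (hint _ (hWconv hu hv (sub_nonneg.2 h1) h0 (by ring)))
    ((hi1.add hi2).sub hi3) ?_
  filter_upwards [hB] with z hz
  have h := hlin.le_convexComb z.2 (abs_inner_le_of_norm_le hz (hWR u hu))
    (abs_inner_le_of_norm_le hz (hWR v hv)) h0 h1
  simpa only [sampleLoss, inner_add_right, inner_sub_right, real_inner_smul_right] using h

lemma convexOn_risk (hB : ∀ᵐ z ∂Pi, ‖z.1‖ ≤ B) (hWconv : Convex ℝ W)
    (hWR : ∀ w ∈ W, ‖w‖ ≤ R) (hlam : 0 < lam)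
    (hlin : LinearStrongConvexity loss loss' lam G (R * B))
    (hint : ∀ w ∈ W, Integrable (sampleLoss loss w) Pi) : ConvexOn ℝ W (risk loss Pi) := by
  refine ⟨hWconv, fun u hu v hv a b ha hb hab => ?_⟩
  obtain rfl : a = 1 - b := by linarith
  have h := risk_convexComb_le hB hWconv hWR hlin hint hu hv hb (by linarith : b ≤ 1)
  have h2 : 0 ≤ b * (1 - b) * (lam / 2 * ∫ z, (inner ℝ z.1 (v - u)) ^ 2 ∂Pi) := by
    have : 0 ≤ ∫ z, (inner ℝ z.1 (v - u)) ^ 2 ∂Pi := integral_nonneg fun z => sq_nonneg _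
    positivity
  simp only [smul_eq_mul]
  linarith

/-- The loss is strongly convex only along x; integrating over Π turns ⟨x, v - w*⟩² into the form of
Cov, which is nondegenerate. -/
lemma risk_growth (hB : ∀ᵐ z ∂Pi, ‖z.1‖ ≤ B) (hWconv : Convex ℝ W)
    (hWR : ∀ w ∈ W, ‖w‖ ≤ R) (hlam : 0 < lam)
    (hlin : LinearStrongConvexity loss loss' lam G (R * B))
    (hint : ∀ w ∈ W, Integrable (sampleLoss loss w) Pi) (hwstar : wstar ∈ W)
    (hmin : IsMinOn (risk loss Pi) W wstar) {v : EuclideanSpace ℝ (Fin d)} (hv : v ∈ W) :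
    lam / 2 * lambdaMin (secondMoment Pi) * ‖v - wstar‖ ^ 2 ≤
      risk loss Pi v - risk loss Pi wstar := by
  have h : risk loss Pi wstar + lam / 2 * ∫ z, (inner ℝ z.1 (v - wstar)) ^ 2 ∂Pi
      ≤ risk loss Pi v := by
    refine add_le_of_forall_convexComb fun s h0 h1 => ?_
    exact (hmin (hWconv hwstar hv (by linarith) h0.le (by ring))).trans
      (risk_convexComb_le hB hWconv hWR hlin hint hwstar hv h0.le h1.le)
  have h2 := mul_le_mul_of_nonneg_left (lambdaMin_secondMoment_mul_le hB (v - wstar))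
    (by positivity : 0 ≤ lam / 2)
  linarith

/-- The excess loss of `w` over `wstar` on the sample `z`, set to `0` outside the ball of
radius `B`. -/
def excessLoss (loss : Y → ℝ → ℝ) (B : ℝ) (wstar w : EuclideanSpace ℝ (Fin d))
    (z : EuclideanSpace ℝ (Fin d) × Y) : ℝ :=
  if ‖z.1‖ ≤ B then sampleLoss loss w z - sampleLoss loss wstar z else 0

lemma measurable_uncurry_excessLoss (hloss : Measurable (Function.uncurry loss)) :
    Measurable (Function.uncurry (excessLoss loss B wstar)) := by
  refine Measurable.ite (measurableSet_le (by fun_prop) measurable_const) ?_ measurable_const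
  refine Measurable.sub ?_ ?_
  · exact hloss.comp (f := fun p : EuclideanSpace ℝ (Fin d) × (EuclideanSpace ℝ (Fin d) × Y) =>
      (p.2.2, inner ℝ p.2.1 p.1)) (by fun_prop)
  · exact hloss.comp (f := fun p : EuclideanSpace ℝ (Fin d) × (EuclideanSpace ℝ (Fin d) × Y) =>
      (p.2.2, inner ℝ p.2.1 wstar)) (by fun_prop)

omit [MeasurableSpace Y] in
lemma abs_excessLoss_le (hWR : ∀ w ∈ W, ‖w‖ ≤ R) (hlam : 0 < lam)
    (hlin : LinearStrongConvexity loss loss' lam G (R * B)) (hwstar : wstar ∈ W)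
    {w : EuclideanSpace ℝ (Fin d)} (hw : w ∈ W) (z : EuclideanSpace ℝ (Fin d) × Y) :
    |excessLoss loss B wstar w z| ≤ 2 * G ^ 2 / lam := by
  unfold excessLoss
  split_ifs with hz
  · exact hlin.abs_sub_le hlam z.2 (abs_inner_le_of_norm_le hz (hWR _ hwstar))
      (abs_inner_le_of_norm_le hz (hWR w hw))
  · rw [abs_zero]; positivity

omit [MeasurableSpace Y] in
lemma abs_sampleLoss_sub_le (hWR : ∀ w ∈ W, ‖w‖ ≤ R)
    (hlin : LinearStrongConvexity loss loss' lam G (R * B))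
    {u v : EuclideanSpace ℝ (Fin d)} (hu : u ∈ W) (hv : v ∈ W)
    {z : EuclideanSpace ℝ (Fin d) × Y} (hz : ‖z.1‖ ≤ B) :
    |sampleLoss loss u z - sampleLoss loss v z| ≤ G * |inner ℝ z.1 (u - v)| := by
  have h := hlin.lipschitz z.2 _ _ (abs_inner_le_of_norm_le hz (hWR v hv))
    (abs_inner_le_of_norm_le hz (hWR u hu))
  rwa [abs_sub_comm (inner ℝ z.1 v), ← inner_sub_right] at h

omit [MeasurableSpace Y] in
lemma abs_excessLoss_sub_le (hB0 : 0 ≤ B) (hR0 : 0 ≤ R) (hWR : ∀ w ∈ W, ‖w‖ ≤ R)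
    (hlin : LinearStrongConvexity loss loss' lam G (R * B))
    {u v : EuclideanSpace ℝ (Fin d)} (hu : u ∈ W) (hv : v ∈ W)
    (z : EuclideanSpace ℝ (Fin d) × Y) :
    |excessLoss loss B wstar u z - excessLoss loss B wstar v z| ≤ G * B * ‖u - v‖ := by
  have hG := hlin.lipschitz_const_nonneg (mul_nonneg hR0 hB0) z.2
  unfold excessLoss
  split_ifs with hz
  · rw [sub_sub_sub_cancel_right]
    refine (abs_sampleLoss_sub_le hWR hlin hu hv hz).trans ?_
    rw [mul_assoc]
    gcongr
    exact (abs_real_inner_le_norm _ _).trans (by gcongr)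
  · rw [sub_zero, abs_zero]; positivity

lemma integrable_excessLoss (hloss : Measurable (Function.uncurry loss))
    (hWR : ∀ w ∈ W, ‖w‖ ≤ R) (hlam : 0 < lam)
    (hlin : LinearStrongConvexity loss loss' lam G (R * B)) (hwstar : wstar ∈ W)
    {w : EuclideanSpace ℝ (Fin d)} (hw : w ∈ W) : Integrable (excessLoss loss B wstar w) Pi :=
  Integrable.of_bound (C := 2 * G ^ 2 / lam)
    ((measurable_uncurry_excessLoss hloss).of_uncurry_left).aestronglyMeasurable
    (Filter.Eventually.of_forall fun z =>
      abs_excessLoss_le hWR hlam hlin hwstar hw z)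

omit [IsProbabilityMeasure Pi] in
lemma integral_excessLoss (hB : ∀ᵐ z ∂Pi, ‖z.1‖ ≤ B)
    (hint : ∀ w ∈ W, Integrable (sampleLoss loss w) Pi) (hwstar : wstar ∈ W)
    {w : EuclideanSpace ℝ (Fin d)} (hw : w ∈ W) :
    ∫ z, excessLoss loss B wstar w z ∂Pi = risk loss Pi w - risk loss Pi wstar := by
  rw [risk, risk, ← integral_sub (hint w hw) (hint wstar hwstar)]
  refine integral_congr_ae ?_
  filter_upwards [hB] with z hz
  rw [excessLoss, if_pos hz]

lemma risk_sub_le (hB : ∀ᵐ z ∂Pi, ‖z.1‖ ≤ B) (hWR : ∀ w ∈ W, ‖w‖ ≤ R) (hlam : 0 < lam)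
    (hlin : LinearStrongConvexity loss loss' lam G (R * B))
    (hint : ∀ w ∈ W, Integrable (sampleLoss loss w) Pi) (hwstar : wstar ∈ W)
    {w : EuclideanSpace ℝ (Fin d)} (hw : w ∈ W) :
    risk loss Pi w - risk loss Pi wstar ≤ 2 * G ^ 2 / lam := by
  rw [risk, risk, ← integral_sub (hint w hw) (hint wstar hwstar)]
  have h : ∫ z, (sampleLoss loss w z - sampleLoss loss wstar z) ∂Pi ≤ ∫ _z, 2 * G ^ 2 / lam ∂Pi := by
    refine integral_mono_ae ((hint w hw).sub (hint wstar hwstar)) (integrable_const _) ?_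
    filter_upwards [hB] with z hz
    exact (le_abs_self _).trans (hlin.abs_sub_le hlam z.2
      (abs_inner_le_of_norm_le hz (hWR _ hwstar)) (abs_inner_le_of_norm_le hz (hWR w hw)))
  simpa using h

lemma measurable_risk (hloss : Measurable (Function.uncurry loss)) :
    Measurable (risk loss Pi) := by
  have h : Measurable (Function.uncurry fun (w : EuclideanSpace ℝ (Fin d))
      (z : EuclideanSpace ℝ (Fin d) × Y) => sampleLoss loss w z) :=
    hloss.comp (f := fun p : EuclideanSpace ℝ (Fin d) × (EuclideanSpace ℝ (Fin d) × Y) =>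
      (p.2.2, inner ℝ p.2.1 p.1)) (by fun_prop)
  exact h.stronglyMeasurable.integral_prod_right.measurable

lemma avgPredictor_mem (hWconv : Convex ℝ W) {w : ℕ → EuclideanSpace ℝ (Fin d)}
    (hw : ∀ t, 1 ≤ t → w t ∈ W) {n : ℕ} (hn : 1 ≤ n) : avgPredictor w n ∈ W := by
  have hn0 : (n : ℝ) ≠ 0 := by positivity
  rw [avgPredictor, Finset.smul_sum]
  exact hWconv.sum_mem (fun _ _ => by positivity) (by simp [hn0])
    fun t ht => hw t (Finset.mem_Icc.1 ht).1

omit [IsProbabilityMeasure Pi] in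
lemma risk_avgPredictor_le (hconv : ConvexOn ℝ W (risk loss Pi))
    {w : ℕ → EuclideanSpace ℝ (Fin d)} (hw : ∀ t, 1 ≤ t → w t ∈ W) {n : ℕ} (hn : 1 ≤ n) :
    n * (risk loss Pi (avgPredictor w n) - risk loss Pi wstar) ≤
      ∑ t ∈ Finset.Icc 1 n, (risk loss Pi (w t) - risk loss Pi wstar) := by
  have hn0 : (n : ℝ) ≠ 0 := by positivity
  have h := hconv.map_sum_le (t := Finset.Icc 1 n) (w := fun _ => (n : ℝ)⁻¹) (p := w)
    (fun _ _ => by positivity) (by simp [hn0]) fun t ht => hw t (Finset.mem_Icc.1 ht).1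
  rw [← Finset.smul_sum, ← Finset.smul_sum, ← avgPredictor, smul_eq_mul,
    inv_mul_eq_div, le_div_iff₀ (by positivity)] at h
  rw [Finset.sum_sub_distrib, Finset.sum_const, Nat.card_Icc, nsmul_eq_mul, Nat.add_sub_cancel]
  linarith

end Risk

/-! ### Total variation and φ-mixing estimates for expectations. -/

section Mixing

variable {S : Type*} [MeasurableSpace S]

lemma abs_measureReal_sub_le_one (P Q : Measure S) [IsProbabilityMeasure P]
    [IsProbabilityMeasure Q] (A : Set S) : |P.real A - Q.real A| ≤ 1 :=
  abs_sub_le_of_nonneg_of_le measureReal_nonneg measureReal_le_one measureReal_nonneg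
    measureReal_le_one

lemma abs_measureReal_sub_le_tvDist (P Q : Measure S) [IsProbabilityMeasure P]
    [IsProbabilityMeasure Q] {A : Set S} (hA : MeasurableSet A) :
    |P.real A - Q.real A| ≤ tvDist P Q :=
  le_ciSup (f := fun A : {A : Set S // MeasurableSet A} => |P.real A - Q.real A|)
    ⟨1, by rintro _ ⟨A, rfl⟩; exact abs_measureReal_sub_le_one P Q A⟩ ⟨A, hA⟩

lemma tvDist_le_one (P Q : Measure S) [IsProbabilityMeasure P] [IsProbabilityMeasure Q] :
    tvDist P Q ≤ 1 :=
  have : Nonempty {A : Set S // MeasurableSet A} := ⟨⟨∅, MeasurableSet.empty⟩⟩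
  ciSup_le fun A => abs_measureReal_sub_le_one P Q A

/-- Layer cake: g + M takes values in [0, 2M], and at each level the superlevel sets have measures
differing by at most the total variation distance. -/
lemma abs_integral_sub_le_tvDist (P Q : Measure S) [IsProbabilityMeasure P]
    [IsProbabilityMeasure Q] {g : S → ℝ} (hg : Measurable g) {M : ℝ} (hM : 0 ≤ M)
    (hgM : ∀ z, |g z| ≤ M) : |∫ z, g z ∂P - ∫ z, g z ∂Q| ≤ M * (2 * tvDist P Q) := by
  have hint : ∀ (μ : Measure S) [IsProbabilityMeasure μ], Integrable g μ := fun μ _ =>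
    Integrable.of_bound hg.aestronglyMeasurable M (Filter.Eventually.of_forall hgM)
  have hlayer : ∀ (μ : Measure S) [IsProbabilityMeasure μ],
      ∫ z, g z ∂μ + M = ∫ s in Set.Ioc 0 (2 * M), μ.real {z | s ≤ g z + M} := by
    intro μ _
    rw [← Integrable.integral_eq_integral_Ioc_meas_le (f := fun z => g z + M)
      ((hint μ).add (integrable_const M))
      (Filter.Eventually.of_forall fun z => by
        have := (abs_le.1 (hgM z)).1; simp only [Pi.zero_apply]; linarith)
      (Filter.Eventually.of_forall fun z => by
        have := (abs_le.1 (hgM z)).2; linarith), integral_add (hint μ) (integrable_const M)]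
    simp
  have hmono : ∀ (μ : Measure S) [IsProbabilityMeasure μ],
      IntegrableOn (fun s => μ.real {z | s ≤ g z + M}) (Set.Ioc 0 (2 * M)) := by
    intro μ _
    have hanti : Antitone fun s => μ.real {z | s ≤ g z + M} := fun a b hab =>
      measureReal_mono fun z hz => le_trans hab hz
    exact Measure.integrableOn_of_bounded (M := 1) measure_Ioc_lt_top.ne
      hanti.measurable.aestronglyMeasurable (Filter.Eventually.of_forall fun s => by
        rw [Real.norm_eq_abs, abs_of_nonneg measureReal_nonneg]; exact measureReal_le_one)
  have e : ∫ z, g z ∂P - ∫ z, g z ∂Q = ∫ s in Set.Ioc 0 (2 * M),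
      (P.real {z | s ≤ g z + M} - Q.real {z | s ≤ g z + M}) := by
    rw [integral_sub (hmono P) (hmono Q), ← hlayer P, ← hlayer Q]
    ring
  rw [e]
  have h := norm_setIntegral_le_of_norm_le_const (μ := volume) (s := Set.Ioc 0 (2 * M))
    (C := tvDist P Q) (f := fun s => P.real {z | s ≤ g z + M} - Q.real {z | s ≤ g z + M})
    measure_Ioc_lt_top fun s _ => abs_measureReal_sub_le_tvDist P Q
      (measurableSet_le measurable_const (hg.add_const M))
  rw [Real.norm_eq_abs, Real.volume_real_Ioc_of_le (by linarith)] at h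
  linarith

variable {Ω : Type*} [MeasurableSpace Ω] {P : Measure Ω} [IsProbabilityMeasure P]
  {ξ : ℕ → Ω → S} {Pi : Measure S} [IsProbabilityMeasure Pi]

lemma history_le (hξ : ∀ t, 1 ≤ t → Measurable (ξ t)) (t : ℕ) :
    history ξ t ≤ (inferInstance : MeasurableSpace Ω) :=
  iSup₂_le fun i hi => (hξ i (Finset.mem_Icc.1 hi).1).comap_le

omit [MeasurableSpace Ω] in
lemma history_mono : Monotone (history ξ) := by
  intro s t hst
  refine iSup₂_le fun i hi => ?_
  exact le_iSup₂_of_le i (Finset.Icc_subset_Icc_right hst hi) le_rfl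

omit [MeasurableSpace Ω] in
lemma measurable_history {i t : ℕ} (hi : 1 ≤ i) (hit : i ≤ t) : Measurable[history ξ t] (ξ i) := by
  refine Measurable.of_comap_le ?_
  exact le_iSup₂_of_le i (Finset.mem_Icc.2 ⟨hi, hit⟩) le_rfl

omit [IsProbabilityMeasure P] [IsProbabilityMeasure Pi] in
lemma phiMixing_nonneg (k : ℕ) : 0 ≤ phiMixing P ξ Pi k := by
  refine Real.sSup_nonneg ?_
  rintro r ⟨t, _, B, _, _, rfl⟩
  exact mul_nonneg zero_le_two (Real.iSup_nonneg fun A => abs_nonneg _)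

lemma two_mul_tvDist_le_phiMixing (hξ : ∀ t, 1 ≤ t → Measurable (ξ t)) {t : ℕ} (ht : 1 ≤ t)
    (k : ℕ) {A : Set Ω} (hA : MeasurableSet[history ξ t] A) (hPA : P A ≠ 0) :
    2 * tvDist ((ProbabilityTheory.cond P A).map (ξ (t + k))) Pi ≤ phiMixing P ξ Pi k := by
  refine le_csSup ⟨2, ?_⟩ ⟨t, ht, A, hA, hPA, rfl⟩
  rintro r ⟨t, ht, B, _, hPB, rfl⟩
  have := cond_isProbabilityMeasure hPB
  have := Measure.isProbabilityMeasure_map (μ := ProbabilityTheory.cond P B)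
    (hξ (t + k) (by omega)).aemeasurable
  linarith [tvDist_le_one ((ProbabilityTheory.cond P B).map (ξ (t + k))) Pi]

/-- For P A ≠ 0 this is, up to the factor P A, the mixing bound for the law conditioned on A; null
sets contribute 0. -/
lemma setIntegral_mixing_nonneg (hξ : ∀ t, 1 ≤ t → Measurable (ξ t)) {t : ℕ} (ht : 1 ≤ t)
    (k : ℕ) {g : S → ℝ} (hg : Measurable g) {M : ℝ} (hM : 0 ≤ M) (hgM : ∀ z, |g z| ≤ M)
    {A : Set Ω} (hA : MeasurableSet[history ξ t] A) :
    0 ≤ ∫ ω in A, (g (ξ (t + k) ω) - ∫ z, g z ∂Pi + M * phiMixing P ξ Pi k) ∂P := by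
  by_cases hPA : P A = 0
  · rw [Measure.restrict_eq_zero.2 hPA, integral_zero_measure]
  have hξk := hξ (t + k) (by omega)
  have := cond_isProbabilityMeasure hPA
  have := Measure.isProbabilityMeasure_map (μ := ProbabilityTheory.cond P A) hξk.aemeasurable
  have h1 := abs_integral_sub_le_tvDist ((ProbabilityTheory.cond P A).map (ξ (t + k))) Pi hg hM hgM
  have h2 := mul_le_mul_of_nonneg_left
    (two_mul_tvDist_le_phiMixing (P := P) (Pi := Pi) hξ ht k hA hPA) hM
  rw [integral_map hξk.aemeasurable hg.aestronglyMeasurable] at h1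
  have hint : Integrable (fun ω => g (ξ (t + k) ω)) (ProbabilityTheory.cond P A) :=
    Integrable.of_bound (hg.comp hξk).aestronglyMeasurable M
      (Filter.Eventually.of_forall fun ω => hgM _)
  have h3 : 0 ≤ ∫ ω, (g (ξ (t + k) ω) - ∫ z, g z ∂Pi + M * phiMixing P ξ Pi k)
      ∂(ProbabilityTheory.cond P A) := by
    rw [integral_add (by exact hint.sub (integrable_const _)) (integrable_const _),
      integral_sub hint (integrable_const _), integral_const, integral_const]
    simp only [probReal_univ, one_smul]
    have := (abs_le.1 h1).1
    linarith
  rw [ProbabilityTheory.cond, integral_smul_measure] at h3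
  have hpos : 0 < ((P A)⁻¹).toReal :=
    ENNReal.toReal_pos (ENNReal.inv_ne_zero.2 (measure_ne_top P A)) (ENNReal.inv_ne_top.2 hPA)
  exact (smul_nonneg_iff_nonneg_of_pos_left hpos).1 h3

end Mixing

/-! ### From events to adapted weights and adapted parameters. -/

section Decoupling

/-- The set condition says that E[D | m] ≥ 0, and Z can be pulled out of the conditional
expectation. -/
lemma integral_mul_nonneg_of_setIntegral_nonneg {Ω : Type*} {m mΩ : MeasurableSpace Ω}
    {P : Measure Ω} [IsFiniteMeasure P] (hm : m ≤ mΩ) {D Z : Ω → ℝ} (hD : Integrable D P)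
    (hset : ∀ A, MeasurableSet[m] A → 0 ≤ ∫ ω in A, D ω ∂P) (hZ : Measurable[m] Z)
    (hZ0 : ∀ ω, 0 ≤ Z ω) {C : ℝ} (hZC : ∀ ω, Z ω ≤ C) : 0 ≤ ∫ ω, Z ω * D ω ∂P := by
  have hcond : 0 ≤ᵐ[P] P[D | m] := by
    refine ae_of_ae_trim (P := fun ω => 0 ≤ (P[D | m]) ω) hm ?_
    refine ae_nonneg_of_forall_setIntegral_nonneg
      (integrable_condExp.trim hm stronglyMeasurable_condExp) fun A hA _ => ?_
    rw [← setIntegral_trim hm stronglyMeasurable_condExp hA, setIntegral_condExp hm hD hA]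
    exact hset A hA
  have hbound : ∀ᵐ ω ∂P, ‖Z ω‖ ≤ C := Filter.Eventually.of_forall fun ω => by
    rw [Real.norm_eq_abs, abs_of_nonneg (hZ0 ω)]; exact hZC ω
  have hpull := condExp_stronglyMeasurable_mul_of_bound hm
    (Measurable.stronglyMeasurable hZ) hD C hbound
  have e : ∫ ω, Z ω * D ω ∂P = ∫ ω, Z ω * (P[D | m]) ω ∂P := by
    rw [← integral_condExp hm (f := fun ω => Z ω * D ω)]
    exact integral_congr_ae hpull
  rw [e]
  refine integral_nonneg_of_ae ?_
  filter_upwards [hcond] with ω hω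
  exact mul_nonneg (hZ0 ω) hω

/-- Replaces a fixed parameter v by an m-measurable one. For a simple function, the indicators of
its level sets are absorbed into the weight Z; the general case follows by approximation and
dominated convergence. -/
lemma integral_mul_apply_nonneg {Ω S E : Type*} [MeasurableSpace S] [NormedAddCommGroup E]
    [MeasurableSpace E] [BorelSpace E] [SecondCountableTopology E] {m mΩ : MeasurableSpace Ω}
    {P : Measure Ω} [IsProbabilityMeasure P] (hm : m ≤ mΩ) {W : Set E} {D : E → S → ℝ}
    (hDm : Measurable (Function.uncurry D)) {C : ℝ} (hDC : ∀ v ∈ W, ∀ z, |D v z| ≤ C)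
    (hDcont : ∀ z, ContinuousOn (fun v => D v z) W) {a : Ω → E} (ha : Measurable[m] a)
    (haW : ∀ ω, a ω ∈ W) {ζ : Ω → S} (hζ : Measurable ζ)
    (hfix : ∀ v ∈ W, ∀ Z : Ω → ℝ, Measurable[m] Z → (∀ ω, 0 ≤ Z ω) → (∃ C', ∀ ω, Z ω ≤ C') →
      0 ≤ ∫ ω, Z ω * D v (ζ ω) ∂P)
    {Z : Ω → ℝ} (hZ : Measurable[m] Z) (hZ0 : ∀ ω, 0 ≤ Z ω) {C' : ℝ} (hZC : ∀ ω, Z ω ≤ C') :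
    0 ≤ ∫ ω, Z ω * D (a ω) (ζ ω) ∂P := by
  obtain ⟨ω₀⟩ : Nonempty Ω := nonempty_of_isProbabilityMeasure P
  -- The approximants take values in W, where the bound and `hfix` are available.
  let s : ℕ → @SimpleFunc Ω m E := fun n =>
    @SimpleFunc.approxOn E Ω _ _ _ m a ha W (a ω₀) (haW ω₀) _ n
  have hsW : ∀ n ω, s n ω ∈ W := fun n ω =>
    @SimpleFunc.approxOn_mem E Ω _ _ _ m a ha W (a ω₀) (haW ω₀) _ n ω
  have hslim : ∀ ω, Filter.Tendsto (fun n => s n ω) Filter.atTop (nhds (a ω)) := fun ω =>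
    @SimpleFunc.tendsto_approxOn E Ω _ _ _ m a ha W (a ω₀) (haW ω₀) _ ω (subset_closure (haW ω))
  have hsm : ∀ n, Measurable (s n) := fun n => (@SimpleFunc.measurable Ω E m _ (s n)).mono hm le_rfl
  have hZm : Measurable Z := hZ.mono hm le_rfl
  have hbd : ∀ v ∈ W, ∀ ω, ‖Z ω * D v (ζ ω)‖ ≤ C' * C := by
    intro v hv ω
    rw [norm_mul, Real.norm_eq_abs, Real.norm_eq_abs, abs_of_nonneg (hZ0 ω)]
    exact mul_le_mul (hZC ω) (hDC v hv _) (abs_nonneg _) ((hZ0 ω).trans (hZC ω))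
  have hsimple : ∀ n, 0 ≤ ∫ ω, Z ω * D (s n ω) (ζ ω) ∂P := by
    intro n
    classical
    have e : ∀ ω, Z ω * D (s n ω) (ζ ω)
        = ∑ v ∈ @SimpleFunc.range Ω E m (s n), ((s n) ⁻¹' {v}).indicator Z ω * D v (ζ ω) := by
      intro ω
      rw [Finset.sum_eq_single (s n ω)]
      · rw [Set.indicator_of_mem (by simp)]
      · intro v _ hv
        rw [Set.indicator_of_notMem (by simpa using hv.symm), zero_mul]
      · intro h; exact absurd (@SimpleFunc.mem_range_self Ω E m (s n) ω) h
    simp_rw [e]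
    have hmem : ∀ v ∈ @SimpleFunc.range Ω E m (s n), v ∈ W := by
      intro v hv
      obtain ⟨ω, rfl⟩ := (@SimpleFunc.mem_range Ω E m (s n) v).1 hv
      exact hsW n ω
    have hind : ∀ v, Measurable[m] (((s n) ⁻¹' {v}).indicator Z) := fun v =>
      hZ.indicator (@SimpleFunc.measurableSet_fiber Ω E m (s n) v)
    have hind0 : ∀ v ω, 0 ≤ ((s n) ⁻¹' {v}).indicator Z ω := fun v ω =>
      Set.indicator_nonneg (fun ω _ => hZ0 ω) ω
    have hindC : ∀ v ω, ((s n) ⁻¹' {v}).indicator Z ω ≤ C' := fun v ω =>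
      (Set.indicator_le_self' (fun ω _ => hZ0 ω) ω).trans (hZC ω)
    rw [integral_finsetSum]
    · exact Finset.sum_nonneg fun v hv => hfix v (hmem v hv) _ (hind v) (hind0 v) ⟨C', hindC v⟩
    · intro v hv
      refine Integrable.of_bound (C := C' * C) (((hind v).mono hm le_rfl).mul
        (hDm.of_uncurry_left.comp hζ)).aestronglyMeasurable (Filter.Eventually.of_forall fun ω => ?_)
      rw [norm_mul, Real.norm_eq_abs, Real.norm_eq_abs, abs_of_nonneg (hind0 v ω)]
      exact mul_le_mul (hindC v ω) (hDC v (hmem v hv) _) (abs_nonneg _)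
        ((hind0 v ω).trans (hindC v ω))
  refine ge_of_tendsto' (tendsto_integral_of_dominated_convergence (fun _ => C' * C)
    (fun n => ?_) (integrable_const _) (fun n => Filter.Eventually.of_forall fun ω =>
      hbd _ (hsW n ω) ω) (Filter.Eventually.of_forall fun ω => ?_)) hsimple
  · exact (hZm.mul (hDm.comp ((hsm n).prodMk hζ))).aestronglyMeasurable
  · refine Filter.Tendsto.const_mul _ ?_
    exact (hDcont (ζ ω) (a ω) (haW ω)).tendsto.comp
      (tendsto_nhdsWithin_iff.2 ⟨hslim ω, Filter.Eventually.of_forall fun n => hsW n ω⟩)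

end Decoupling

/-! ### Measurability of a minimizer. -/

section Argmin

/-- By growth, nearly minimal values occur only near a(ω). So a(ω) lies in a closed C exactly when C
∩ W contains points of value within 1/(k+1) of the minimum for every k, and by continuity countable
dense subsets suffice to test this. -/
lemma measurable_of_quadratic_growth {Ω E : Type*} {m : MeasurableSpace Ω} [NormedAddCommGroup E]
    [MeasurableSpace E] [BorelSpace E] [SecondCountableTopology E] {W : Set E}
    {Φ : Ω → E → ℝ} (hΦm : ∀ v, Measurable fun ω => Φ ω v) (hΦc : ∀ ω, Continuous (Φ ω))
    {a : Ω → E} (haW : ∀ ω, a ω ∈ W) {κ : ℝ} (hκ : 0 < κ)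
    (hgrow : ∀ ω, ∀ v ∈ W, Φ ω (a ω) + κ * ‖v - a ω‖ ^ 2 ≤ Φ ω v) : Measurable a := by
  refine measurable_of_isClosed fun C hC => ?_
  obtain ⟨D, hDsub, hDc, hDd⟩ :=
    (TopologicalSpace.IsSeparable.of_separableSpace (C ∩ W)).exists_countable_dense_subset
  obtain ⟨D', hDsub', hDc', hDd'⟩ :=
    (TopologicalSpace.IsSeparable.of_separableSpace W).exists_countable_dense_subset
  have e : a ⁻¹' C = ⋂ k : ℕ, ⋃ v ∈ D, ⋂ v' ∈ D', {ω | Φ ω v < Φ ω v' + 1 / (k + 1 : ℝ)} := by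
    ext ω
    simp only [Set.mem_preimage, Set.mem_iInter, Set.mem_iUnion, Set.mem_ofPred_eq, exists_prop]
    constructor
    · intro haC k
      have hopen : IsOpen {v | Φ ω v < Φ ω (a ω) + 1 / (k + 1 : ℝ)} :=
        isOpen_lt (hΦc ω) continuous_const
      have hpos : (0 : ℝ) < 1 / (k + 1 : ℝ) := by positivity
      obtain ⟨v, hv, hvD⟩ := mem_closure_iff.1 (hDd ⟨haC, haW ω⟩) _ hopen
        (by simp only [Set.mem_ofPred_eq]; linarith)
      refine ⟨v, hvD, fun v' hv' => lt_of_lt_of_le hv ?_⟩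
      have := hgrow ω v' (hDsub' hv')
      have : 0 ≤ κ * ‖v' - a ω‖ ^ 2 := by positivity
      linarith
    · intro h
      rw [← hC.closure_eq, Metric.mem_closure_iff]
      intro ε hε
      obtain ⟨k, hk⟩ := exists_nat_one_div_lt (show 0 < κ * ε ^ 2 by positivity)
      obtain ⟨v, hvD, hv⟩ := h k
      have hcl : IsClosed {v' | Φ ω v ≤ Φ ω v' + 1 / (k + 1 : ℝ)} :=
        isClosed_le continuous_const ((hΦc ω).add continuous_const)
      have hle : Φ ω v ≤ Φ ω (a ω) + 1 / (k + 1 : ℝ) :=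
        closure_minimal (fun v' hv' => (hv v' hv').le) hcl (hDd' (haW ω))
      refine ⟨v, (hDsub hvD).1, ?_⟩
      have h1 := hgrow ω v (hDsub hvD).2
      have h2 : ‖v - a ω‖ ^ 2 < ε ^ 2 := by
        refine lt_of_mul_lt_mul_left (lt_of_le_of_lt ?_ hk) hκ.le
        linarith
      rw [dist_comm, dist_eq_norm]
      exact lt_of_pow_lt_pow_left₀ 2 hε.le h2
  rw [e]
  refine MeasurableSet.iInter fun k => MeasurableSet.biUnion hDc fun v _ =>
    MeasurableSet.biInter hDc' fun v' _ => measurableSet_lt (hΦm v) ((hΦm v').add_const _)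

end Argmin

/-! ### Exponential moments and blocking modulo τ. -/

section Blocks

/-- From e^{-x} ≤ 1 - x + x² for |x| ≤ 1, with x = θh and h² ≤ cΔ, the conditional mean of e^{-θh}
is at most 1 - q ≤ e^{-q}. The factor e^q is m-measurable and is moved into the weight, which avoids
conditional expectations. -/
lemma integral_mul_exp_le {Ω : Type*} {m mΩ : MeasurableSpace Ω} {P : Measure Ω}
    [IsProbabilityMeasure P] (hm : m ≤ mΩ) {h Δ : Ω → ℝ} {M c θ κ : ℝ}
    (hh : Measurable h) (hΔ : Measurable[m] Δ) (hθ : 0 ≤ θ) (hθM : θ * M ≤ 1)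
    (hhM : ∀ ω, |h ω| ≤ M) (hΔM : ∀ ω, |Δ ω| ≤ M) (hhc : ∀ ω, (h ω) ^ 2 ≤ c * Δ ω)
    (hmix : ∀ Z : Ω → ℝ, Measurable[m] Z → (∀ ω, 0 ≤ Z ω) → (∃ C, ∀ ω, Z ω ≤ C) →
      0 ≤ ∫ ω, Z ω * (h ω - Δ ω + κ) ∂P)
    {Z : Ω → ℝ} (hZ : Measurable[m] Z) (hZ0 : ∀ ω, 0 ≤ Z ω) {C : ℝ} (hZC : ∀ ω, Z ω ≤ C) :
    ∫ ω, Z ω * Real.exp (-θ * h ω + (θ * Δ ω - θ * κ - θ ^ 2 * (c * Δ ω))) ∂P ≤ ∫ ω, Z ω ∂P := by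
  set q : Ω → ℝ := fun ω => θ * Δ ω - θ * κ - θ ^ 2 * (c * Δ ω) with hq
  have hqm : Measurable[m] q :=
    ((hΔ.const_mul θ).sub_const _).sub ((hΔ.const_mul c).const_mul _)
  have hqbd : ∀ ω, |q ω| ≤ θ * M + |θ * κ| + θ ^ 2 * (|c| * M) := by
    intro ω
    have h1 : |θ * Δ ω| ≤ θ * M := by
      rw [abs_mul, abs_of_nonneg hθ]; exact mul_le_mul_of_nonneg_left (hΔM ω) hθ
    have h2 : |θ ^ 2 * (c * Δ ω)| ≤ θ ^ 2 * (|c| * M) := by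
      rw [abs_mul, abs_of_nonneg (sq_nonneg θ), abs_mul]
      have := hΔM ω
      gcongr
    calc |q ω| ≤ |θ * Δ ω - θ * κ| + |θ ^ 2 * (c * Δ ω)| := abs_sub _ _
      _ ≤ |θ * Δ ω| + |θ * κ| + |θ ^ 2 * (c * Δ ω)| := by gcongr; exact abs_sub _ _
      _ ≤ _ := by gcongr
  set K := θ * M + |θ * κ| + θ ^ 2 * (|c| * M) with hK
  set Z' : Ω → ℝ := fun ω => Z ω * Real.exp (q ω) with hZ'
  have hZ'm : Measurable[m] Z' := hZ.mul (Real.measurable_exp.comp hqm)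
  have hZ'0 : ∀ ω, 0 ≤ Z' ω := fun ω => mul_nonneg (hZ0 ω) (Real.exp_pos _).le
  have hZ'C : ∀ ω, Z' ω ≤ C * Real.exp K := fun ω =>
    mul_le_mul (hZC ω) (Real.exp_le_exp.2 ((le_abs_self _).trans (hqbd ω))) (Real.exp_pos _).le
      ((hZ0 ω).trans (hZC ω))
  have hZ'm' : Measurable Z' := hZ'm.mono hm le_rfl
  have hqm' : Measurable q := hqm.mono hm le_rfl
  have hΔm' : Measurable Δ := hΔ.mono hm le_rfl
  have hintZ' : ∀ {f : Ω → ℝ} {L : ℝ}, Measurable f → (∀ ω, |f ω| ≤ L) →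
      Integrable (fun ω => Z' ω * f ω) P := by
    intro f L hf hfL
    refine Integrable.of_bound (C := C * Real.exp K * L) (hZ'm'.mul hf).aestronglyMeasurable
      (Filter.Eventually.of_forall fun ω => ?_)
    rw [norm_mul, Real.norm_eq_abs, Real.norm_eq_abs, abs_of_nonneg (hZ'0 ω)]
    exact mul_le_mul (hZ'C ω) (hfL ω) (abs_nonneg _) ((hZ'0 ω).trans (hZ'C ω))
  have hA : Integrable (fun ω => Z' ω * Real.exp (-q ω)) P :=
    hintZ' (L := Real.exp K) (Real.measurable_exp.comp hqm'.neg) fun ω => by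
      rw [Real.abs_exp]; exact Real.exp_le_exp.2 ((neg_le_abs _).trans (hqbd ω))
  have hBint : Integrable (fun ω => Z' ω * (h ω - Δ ω + κ)) P := by
    refine hintZ' (L := M + M + |κ|) ((hh.sub hΔm').add_const κ) fun ω => ?_
    calc |h ω - Δ ω + κ| ≤ |h ω - Δ ω| + |κ| := abs_add_le _ _
      _ ≤ |h ω| + |Δ ω| + |κ| := by gcongr; exact abs_sub _ _
      _ ≤ _ := by gcongr; exacts [hhM ω, hΔM ω]
  have hD : Integrable (fun ω => Z' ω * Real.exp (-θ * h ω)) P := by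
    refine hintZ' (L := Real.exp (θ * M)) (Real.measurable_exp.comp (hh.const_mul _)) fun ω => ?_
    rw [Real.abs_exp]
    refine Real.exp_le_exp.2 ?_
    have := mul_le_mul_of_nonneg_left (abs_le.1 (hhM ω)).1 hθ
    linarith
  have hpt : ∀ ω, Z' ω * Real.exp (-θ * h ω) ≤
      Z' ω * Real.exp (-q ω) - θ * (Z' ω * (h ω - Δ ω + κ)) := by
    intro ω
    have hθh : |-θ * h ω| ≤ 1 := by
      rw [abs_mul, abs_neg, abs_of_nonneg hθ]
      exact (mul_le_mul_of_nonneg_left (hhM ω) hθ).trans hθM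
    have h1 := (abs_le.1 (Real.abs_exp_sub_one_sub_id_le hθh)).2
    have h2 : (-θ * h ω) ^ 2 ≤ θ ^ 2 * (c * Δ ω) := by
      rw [mul_pow, neg_sq]; exact mul_le_mul_of_nonneg_left (hhc ω) (sq_nonneg θ)
    have h3 := Real.add_one_le_exp (-q ω)
    have h4 : Real.exp (-θ * h ω) ≤ Real.exp (-q ω) - θ * (h ω - Δ ω + κ) := by
      simp only [hq] at h3 ⊢
      linarith
    have h5 := mul_le_mul_of_nonneg_left h4 (hZ'0 ω)
    linarith
  have e1 : ∀ ω, Z ω * Real.exp (-θ * h ω + q ω) = Z' ω * Real.exp (-θ * h ω) := by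
    intro ω; rw [Real.exp_add, hZ']; ring
  have e2 : ∀ ω, Z' ω * Real.exp (-q ω) = Z ω := by
    intro ω; rw [hZ', mul_assoc, ← Real.exp_add, add_neg_cancel, Real.exp_zero, mul_one]
  calc ∫ ω, Z ω * Real.exp (-θ * h ω + q ω) ∂P = ∫ ω, Z' ω * Real.exp (-θ * h ω) ∂P := by
        simp_rw [e1]
    _ ≤ ∫ ω, (Z' ω * Real.exp (-q ω) - θ * (Z' ω * (h ω - Δ ω + κ))) ∂P :=
        integral_mono hD (hA.sub (hBint.const_mul θ)) hpt
    _ = ∫ ω, Z ω ∂P - θ * ∫ ω, Z' ω * (h ω - Δ ω + κ) ∂P := by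
        rw [integral_sub hA (hBint.const_mul θ), integral_const_mul]; simp_rw [e2]
    _ ≤ ∫ ω, Z ω ∂P := by
        have := mul_nonneg hθ (hmix Z' hZ'm hZ'0 ⟨_, hZ'C⟩)
        linarith

variable {Ω : Type*} [mΩ : MeasurableSpace Ω] {P : Measure Ω} [IsProbabilityMeasure P]

/-- With stride τ, every earlier term of the block is known at the time of the last one, so the last
exponential can be peeled off. -/
lemma integral_exp_block_le_one {m : ℕ → MeasurableSpace Ω} (hmono : Monotone m) {τ : ℕ} {y : ℕ → Ω → ℝ} {C : ℝ}
    (hy : ∀ t, 1 ≤ t → Measurable[m (t + τ)] (y t)) (hyC : ∀ t, 1 ≤ t → ∀ ω, |y t ω| ≤ C)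
    (hstep : ∀ t, 1 ≤ t → ∀ Z : Ω → ℝ, Measurable[m t] Z → (∀ ω, 0 ≤ Z ω) →
      (∃ C', ∀ ω, Z ω ≤ C') → ∫ ω, Z ω * Real.exp (y t ω) ∂P ≤ ∫ ω, Z ω ∂P)
    {j : ℕ} (hj : 1 ≤ j) (K : ℕ) :
    ∫ ω, Real.exp (∑ k ∈ Finset.range K, y (j + k * τ) ω) ∂P ≤ 1 := by
  induction K with
  | zero => simp
  | succ K ih =>
    refine le_trans ?_ ih
    simp_rw [Finset.sum_range_succ, Real.exp_add]
    refine hstep (j + K * τ) (by omega) _ ?_ (fun ω => (Real.exp_pos _).le)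
      ⟨Real.exp (∑ _k ∈ Finset.range K, C), fun ω => ?_⟩
    · refine Real.measurable_exp.comp (Finset.measurable_sum _ fun k hk => ?_)
      refine (hy (j + k * τ) (by omega)).mono (hmono ?_) le_rfl
      have : (k + 1) * τ ≤ K * τ := Nat.mul_le_mul_right τ (Finset.mem_range.1 hk)
      linarith
    · refine Real.exp_le_exp.2 (Finset.sum_le_sum fun k _ => ?_)
      exact (le_abs_self _).trans (hyC (j + k * τ) (by omega) ω)

lemma sum_range_mul_eq (f : ℕ → ℝ) (N τ : ℕ) :
    ∑ t ∈ Finset.range (N * τ), f t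
      = ∑ j ∈ Finset.range τ, ∑ k ∈ Finset.range N, f (j + k * τ) := by
  induction N with
  | zero => simp
  | succ N ih =>
    simp_rw [Finset.sum_range_succ]
    rw [Finset.sum_add_distrib, ← ih, Nat.add_mul, one_mul, Finset.sum_range_add]
    simp_rw [add_comm (N * τ)]

/-- A concentration inequality for sums whose terms with indices congruent modulo `τ` are
exponential supermartingale increments. -/
theorem measureReal_blocked_sum_gt_le {m : ℕ → MeasurableSpace Ω} (hm : ∀ t, m t ≤ mΩ)
    (hmono : Monotone m) {τ : ℕ} (hτ : 1 ≤ τ) {y : ℕ → Ω → ℝ} {C : ℝ}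
    (hy : ∀ t, 1 ≤ t → Measurable[m (t + τ)] (y t)) (hyC : ∀ t, 1 ≤ t → ∀ ω, |y t ω| ≤ C)
    (hstep : ∀ t, 1 ≤ t → ∀ Z : Ω → ℝ, Measurable[m t] Z → (∀ ω, 0 ≤ Z ω) →
      (∃ C', ∀ ω, Z ω ≤ C') → ∫ ω, Z ω * Real.exp (y t ω) ∂P ≤ ∫ ω, Z ω ∂P)
    (N : ℕ) {δ : ℝ} (hδ : 0 < δ) :
    P.real {ω | τ * Real.log (1 / δ) < ∑ t ∈ Finset.Icc 1 N, y t ω} ≤ δ := by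
  have hτ0 : (0 : ℝ) < τ := by positivity
  have hC0 : 0 ≤ C := by
    obtain ⟨ω₀⟩ : Nonempty Ω := nonempty_of_isProbabilityMeasure P
    exact (abs_nonneg _).trans (hyC 1 le_rfl ω₀)
  -- Padding by zeros beyond N makes every residue class have exactly N terms, whether or not τ
  -- divides N.
  let y' : ℕ → Ω → ℝ := fun t => if t ≤ N then y t else 0
  have hy' : ∀ t, 1 ≤ t → Measurable[m (t + τ)] (y' t) := by
    intro t ht
    by_cases h : t ≤ N
    · simpa only [y', if_pos h] using hy t ht
    · simp only [y', if_neg h]; exact measurable_const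
  have hyC' : ∀ t, 1 ≤ t → ∀ ω, |y' t ω| ≤ C := by
    intro t ht ω
    by_cases h : t ≤ N
    · simpa only [y', if_pos h] using hyC t ht ω
    · simpa only [y', if_neg h, Pi.zero_apply, abs_zero] using hC0
  have hstep' : ∀ t, 1 ≤ t → ∀ Z : Ω → ℝ, Measurable[m t] Z → (∀ ω, 0 ≤ Z ω) →
      (∃ C', ∀ ω, Z ω ≤ C') → ∫ ω, Z ω * Real.exp (y' t ω) ∂P ≤ ∫ ω, Z ω ∂P := by
    intro t ht Z h1 h2 h3
    by_cases h : t ≤ N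
    · simpa only [y', if_pos h] using hstep t ht Z h1 h2 h3
    · simp [y', if_neg h]
  have hsum : ∀ ω, ∑ t ∈ Finset.Icc 1 N, y t ω
      = ∑ j ∈ Finset.range τ, ∑ k ∈ Finset.range N, y' (j + 1 + k * τ) ω := by
    intro ω
    have h1 : ∑ t ∈ Finset.Icc 1 N, y t ω = ∑ t ∈ Finset.range (N * τ), y' (t + 1) ω := by
      have h2 : ∑ t ∈ Finset.Icc 1 N, y t ω = ∑ t ∈ Finset.range N, y' (t + 1) ω := by
        rw [← Finset.Ico_add_one_right_eq_Icc, Finset.sum_Ico_eq_sum_range, Nat.add_sub_cancel]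
        refine Finset.sum_congr rfl fun t ht => ?_
        have : t + 1 ≤ N := Finset.mem_range.1 ht
        simp only [y', if_pos this, add_comm 1 t]
      rw [h2]
      refine Finset.sum_subset (Finset.range_mono (Nat.le_mul_of_pos_right N hτ)) fun t _ ht => ?_
      have : ¬ t + 1 ≤ N := by simpa using ht
      simp [y', if_neg this]
    rw [h1, sum_range_mul_eq (fun t => y' (t + 1) ω)]
    simp_rw [Nat.add_right_comm]
  set b : ℕ → Ω → ℝ := fun j ω => ∑ k ∈ Finset.range N, y' (j + 1 + k * τ) ω with hb
  have hbm : ∀ j, Measurable (b j) := fun j => Finset.measurable_sum _ fun k _ =>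
    (hy' (j + 1 + k * τ) (by omega)).mono (hm _) le_rfl
  have hbint : ∀ j, Integrable (fun ω => Real.exp (b j ω)) P := by
    intro j
    refine Integrable.of_bound (C := Real.exp (∑ _k ∈ Finset.range N, C))
      (Real.measurable_exp.comp (hbm j)).aestronglyMeasurable
      (Filter.Eventually.of_forall fun ω => ?_)
    rw [Real.norm_eq_abs, Real.abs_exp]
    exact Real.exp_le_exp.2 (Finset.sum_le_sum fun k _ =>
      (le_abs_self _).trans (hyC' (j + 1 + k * τ) (by omega) ω))
  -- By Jensen, exp of the full sum over τ is at most this average over residue classes. A single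
  -- Markov inequality then suffices, with no union bound over blocks.
  set f : Ω → ℝ := fun ω => ∑ j ∈ Finset.range τ, (τ : ℝ)⁻¹ * Real.exp (b j ω) with hf
  have hfint : ∫ ω, f ω ∂P ≤ 1 := by
    rw [hf, integral_finsetSum _ fun j _ => (hbint j).const_mul _]
    calc ∑ j ∈ Finset.range τ, ∫ ω, (τ : ℝ)⁻¹ * Real.exp (b j ω) ∂P
        ≤ ∑ _j ∈ Finset.range τ, (τ : ℝ)⁻¹ := by
          refine Finset.sum_le_sum fun j _ => ?_
          rw [integral_const_mul]
          exact mul_le_of_le_one_right (by positivity)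
            (integral_exp_block_le_one hmono hy' hyC' hstep' (by omega) N)
      _ = 1 := by simp [hτ0.ne']
  have hmarkov := mul_meas_ge_le_integral_of_nonneg (μ := P) (f := f)
    (Filter.Eventually.of_forall fun ω => Finset.sum_nonneg fun j _ => by positivity)
    (integrable_finsetSum _ fun j _ => (hbint j).const_mul _) (1 / δ)
  have hsub : {ω | τ * Real.log (1 / δ) < ∑ t ∈ Finset.Icc 1 N, y t ω} ⊆ {ω | 1 / δ ≤ f ω} := by
    intro ω hω
    simp only [Set.mem_ofPred_eq] at hω ⊢
    rw [hsum] at hω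
    have hjensen := convexOn_exp.map_sum_le (t := Finset.range τ) (w := fun _ => (τ : ℝ)⁻¹)
      (p := fun j => b j ω) (fun _ _ => by positivity) (by simp [hτ0.ne']) fun _ _ => trivial
    simp only [smul_eq_mul] at hjensen
    refine le_trans ?_ hjensen
    rw [← Real.log_le_iff_le_exp (by positivity), ← Finset.mul_sum, inv_mul_eq_div,
      le_div_iff₀ hτ0, mul_comm]
    exact hω.le
  calc P.real {ω | τ * Real.log (1 / δ) < ∑ t ∈ Finset.Icc 1 N, y t ω}
      ≤ P.real {ω | 1 / δ ≤ f ω} := measureReal_mono hsub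
    _ = δ * (1 / δ * P.real {ω | 1 / δ ≤ f ω}) := by field_simp
    _ ≤ δ * 1 := mul_le_mul_of_nonneg_left (hmarkov.trans hfint) hδ.le
    _ = δ := mul_one δ

end Blocks

/-! ### Adaptedness and delayed regret of the algorithm. -/

section Algorithm

variable {d : ℕ} {Y : Type*} {B R : ℝ} {W : Set (EuclideanSpace ℝ (Fin d))}
  {loss loss' : Y → ℝ → ℝ} {lam G : ℝ} {wstar : EuclideanSpace ℝ (Fin d)}

lemma ftalObjective_eq_leaderObjective (loss' : Y → ℝ → ℝ) (lam : ℝ)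
    (z : ℕ → EuclideanSpace ℝ (Fin d) × Y) (w : ℕ → EuclideanSpace ℝ (Fin d)) (t : ℕ) :
    ftalObjective loss' lam 1 z w t = leaderObjective lam (fun i => (z i).1) w
      (fun i => loss' (z i).2 (inner ℝ (z i).1 (w i))) t := by
  funext v
  simp only [ftalObjective, leaderObjective, cumLoss, sampleGrad, real_inner_smul_left,
    Finset.sum_add_distrib, Finset.mul_sum, real_inner_comm (z _).1 (w _ - v)]
  ring

/-- Keeps only the part of the growth due to the regularizer ε = 1, which is uniform in the sample
and so feeds the measurability criterion. -/
lemma IsFTAL.growth (hlam : 0 < lam) (hWconv : Convex ℝ W)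
    {z : ℕ → EuclideanSpace ℝ (Fin d) × Y} {w : ℕ → EuclideanSpace ℝ (Fin d)}
    (hw : IsFTAL loss' lam 1 W z w) {t : ℕ} (ht : 1 ≤ t) {v : EuclideanSpace ℝ (Fin d)}
    (hv : v ∈ W) : ftalObjective loss' lam 1 z w t (w t) + lam / 2 * ‖v - w t‖ ^ 2 ≤
      ftalObjective loss' lam 1 z w t v := by
  have hmin := (hw t ht).2
  rw [ftalObjective_eq_leaderObjective] at hmin ⊢
  have h := leaderObjective_growth hWconv ht (hw t ht).1 hv hmin
  have h2 : ‖v - w t‖ ^ 2 ≤ regForm (fun i => (z i).1) t (v - w t) :=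
    le_add_of_nonneg_right (Finset.sum_nonneg fun i _ => sq_nonneg _)
  have h3 := mul_le_mul_of_nonneg_left h2 (by positivity : 0 ≤ lam / 2)
  linarith

lemma continuous_ftalObjective (z : ℕ → EuclideanSpace ℝ (Fin d) × Y)
    (w : ℕ → EuclideanSpace ℝ (Fin d)) (t : ℕ) :
    Continuous (ftalObjective loss' lam 1 z w t) := by
  unfold ftalObjective
  fun_prop

lemma measurable_ftalObjective [MeasurableSpace Y] {Ω : Type*} [MeasurableSpace Ω]
    (hloss' : Measurable (Function.uncurry loss')) {ξ : ℕ → Ω → EuclideanSpace ℝ (Fin d) × Y}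
    {w : ℕ → Ω → EuclideanSpace ℝ (Fin d)} {t : ℕ} (ht : 1 ≤ t)
    (hξ : ∀ i, 1 ≤ i → i ≤ t → Measurable (ξ i)) (hw : ∀ i, 1 ≤ i → i < t → Measurable (w i))
    (v : EuclideanSpace ℝ (Fin d)) :
    Measurable fun ω => ftalObjective loss' lam 1 (fun i => ξ i ω) (fun i => w i ω) t v := by
  have hξt := hξ t ht le_rfl
  unfold ftalObjective
  refine Measurable.add (Measurable.add ?_ ?_) (by fun_prop)
  · refine Finset.measurable_sum _ fun i hi => ?_
    have hi' := Finset.mem_Ico.1 hi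
    have h1 := hξ i hi'.1 hi'.2.le
    have h2 := hw i hi'.1 hi'.2
    have h3 : Measurable fun ω => loss' (ξ i ω).2 (inner ℝ (ξ i ω).1 (w i ω)) :=
      hloss'.comp (f := fun ω => ((ξ i ω).2, inner ℝ (ξ i ω).1 (w i ω))) (by fun_prop)
    unfold sampleGrad
    fun_prop
  · refine Measurable.const_mul (Finset.measurable_sum _ fun i hi => ?_) _
    have hi' := Finset.mem_Ico.1 hi
    have h1 := hξ i hi'.1 hi'.2.le
    have h2 := hw i hi'.1 hi'.2
    fun_prop

/-- The iterates are adapted to the filtration of the samples. -/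
lemma measurable_iterate [MeasurableSpace Y] {Ω : Type*}
    (hloss' : Measurable (Function.uncurry loss')) (hlam : 0 < lam) (hWconv : Convex ℝ W)
    {ξ : ℕ → Ω → EuclideanSpace ℝ (Fin d) × Y} {w : ℕ → Ω → EuclideanSpace ℝ (Fin d)}
    (hw : ∀ ω, IsFTAL loss' lam 1 W (fun t => ξ t ω) (fun t => w t ω)) (t : ℕ) :
    1 ≤ t → Measurable[history ξ t] (w t) := by
  -- The objective at time t involves the iterates before t and also x_t itself, so w(t) is
  -- measurable for the history up to t, not t - 1.
  induction t using Nat.strong_induction_on with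
  | _ t ih =>
    intro ht
    refine @measurable_of_quadratic_growth Ω _ (history ξ t) _ _ _ _ W
      (fun ω => ftalObjective loss' lam 1 (fun i => ξ i ω) (fun i => w i ω) t) (fun v => ?_)
      (fun ω => continuous_ftalObjective _ _ t) (w t) (fun ω => (hw ω t ht).1) (lam / 2)
      (by positivity) fun ω v hv => (hw ω).growth hlam hWconv ht hv
    exact @measurable_ftalObjective d Y loss' lam _ Ω (history ξ t) hloss' ξ w t ht
      (fun i h1 h2 => measurable_history h1 h2)
      (fun i h1 h2 => (ih i h2 h1).mono (history_mono h2.le) le_rfl) v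

/-- Along samples in the ball of radius `B`, the losses of the iterates on samples from `τ` steps
ahead have small regret. -/
lemma IsFTAL.sum_excessLoss_le (hlam : 0 < lam) (hWconv : Convex ℝ W) (hWR : ∀ w ∈ W, ‖w‖ ≤ R)
    (hB0 : 0 ≤ B) (hR0 : 0 ≤ R)
    (hlin : LinearStrongConvexity loss loss' lam G (R * B)) (hwstar : wstar ∈ W)
    {z : ℕ → EuclideanSpace ℝ (Fin d) × Y} {w : ℕ → EuclideanSpace ℝ (Fin d)}
    (hw : IsFTAL loss' lam 1 W z w) (hz : ∀ t, 1 ≤ t → ‖(z t).1‖ ≤ B) {n τ : ℕ} (hτ : τ ≤ n) :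
    ∑ t ∈ Finset.Icc 1 (n - τ), excessLoss loss B wstar (w t) (z (t + τ)) ≤
      lam / 2 * ‖wstar‖ ^ 2 + (2 + 6 * τ) * (G ^ 2 / lam) * (d * Real.log (B ^ 2 * n + 1))
        + τ * (2 * G ^ 2 / lam) := by
  set x : ℕ → EuclideanSpace ℝ (Fin d) := fun i => (z i).1 with hx
  set c : ℕ → ℝ := fun i => loss' (z i).2 (inner ℝ (z i).1 (w i)) with hc
  have hwW : ∀ t, 1 ≤ t → w t ∈ W := fun t ht => (hw t ht).1
  have hmin : ∀ t, 1 ≤ t → IsMinOn (leaderObjective lam x w c t) W (w t) := fun t ht => by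
    rw [← ftalObjective_eq_leaderObjective]; exact (hw t ht).2
  have hin : ∀ t, 1 ≤ t → ∀ v ∈ W, |inner ℝ (x t) v| ≤ R * B := fun t ht v hv =>
    abs_inner_le_of_norm_le (hz t ht) (hWR v hv)
  have hcG : ∀ i, 1 ≤ i → |c i| ≤ G := fun i hi =>
    hlin.abs_subgradient_le hlam _ (hin i hi _ (hwW i hi))
  have hxW : ∀ i, 1 ≤ i → ∀ v ∈ W, lam * |inner ℝ (x i) v| ≤ G := fun i hi v hv =>
    (mul_le_mul_of_nonneg_left (hin i hi v hv) hlam.le).trans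
      (hlin.mul_radius_le hlam (mul_nonneg hR0 hB0) (z i).2)
  have hG : 0 ≤ G := (abs_nonneg _).trans (hcG 1 le_rfl)
  obtain ⟨β, hβ, hβx, hβsum⟩ := exists_elliptical_potential (n := n) x
    fun i hi => hz i (Finset.mem_Icc.1 hi).1
  have hreg := leader_regret hlam hWconv hcG hxW hwW hmin hβ hβx n hwstar
  have hstab := leader_stability hlam hWconv hcG hxW hwW hmin hβ hβx hτ
  set Q := ∑ t ∈ Finset.Icc 1 n, β t
  have hex : ∀ t, 1 ≤ t → ∀ v, excessLoss loss B wstar v (z t)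
      = sampleLoss loss v (z t) - sampleLoss loss wstar (z t) := fun t ht v => by
    rw [excessLoss, if_pos (hz t ht)]
  have hround : ∑ t ∈ Finset.Icc 1 n, excessLoss loss B wstar (w t) (z t) ≤
      lam / 2 * ‖wstar‖ ^ 2 + 2 * G ^ 2 / lam * Q := by
    refine (Finset.sum_le_sum fun t ht => ?_).trans hreg
    have ht1 := (Finset.mem_Icc.1 ht).1
    have h := hlin.strong_convex (z t).2 _ _ (hin t ht1 _ (hwW t ht1)) (hin t ht1 _ hwstar)
    rw [hex t ht1, inner_sub_right]
    simp only [sampleLoss]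
    linarith
  -- Dropping the first τ rounds aligns round t + τ with the earlier iterate w(t); stability pays
  -- for swapping the iterates.
  have hsplit : ∑ t ∈ Finset.Icc 1 n, excessLoss loss B wstar (w t) (z t)
      = ∑ t ∈ Finset.Icc 1 τ, excessLoss loss B wstar (w t) (z t)
        + ∑ t ∈ Finset.Icc 1 (n - τ), excessLoss loss B wstar (w (t + τ)) (z (t + τ)) := by
    simp only [← Finset.Ico_add_one_right_eq_Icc, Finset.sum_Ico_eq_sum_range, Nat.add_sub_cancel]
    conv_lhs => rw [show n = τ + (n - τ) by omega, Finset.sum_range_add]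
    simp only [add_left_comm, add_assoc, add_comm τ]
  have hfirst : -(τ * (2 * G ^ 2 / lam)) ≤
      ∑ t ∈ Finset.Icc 1 τ, excessLoss loss B wstar (w t) (z t) := by
    have h : ∑ _t ∈ Finset.Icc 1 τ, -(2 * G ^ 2 / lam) ≤
        ∑ t ∈ Finset.Icc 1 τ, excessLoss loss B wstar (w t) (z t) :=
      Finset.sum_le_sum fun t ht => (abs_le.1 (abs_excessLoss_le hWR hlam hlin hwstar
        (hwW t (Finset.mem_Icc.1 ht).1) (z t))).1
    simpa using h
  have hshift : ∑ t ∈ Finset.Icc 1 (n - τ), excessLoss loss B wstar (w t) (z (t + τ))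
      ≤ ∑ t ∈ Finset.Icc 1 (n - τ), excessLoss loss B wstar (w (t + τ)) (z (t + τ))
        + G * ∑ t ∈ Finset.Icc 1 (n - τ), |inner ℝ (x (t + τ)) (w t - w (t + τ))| := by
    rw [Finset.mul_sum, ← Finset.sum_add_distrib]
    refine Finset.sum_le_sum fun t ht => ?_
    have ht1 := (Finset.mem_Icc.1 ht).1
    have h := (le_abs_self _).trans (abs_sampleLoss_sub_le hWR hlin (hwW t ht1)
      (hwW (t + τ) (by omega)) (hz (t + τ) (by omega)))
    rw [hex _ (by omega), hex _ (by omega)]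
    linarith
  have hstab' : G * ∑ t ∈ Finset.Icc 1 (n - τ), |inner ℝ (x (t + τ)) (w t - w (t + τ))|
      ≤ 6 * τ * (G ^ 2 / lam) * Q := by
    refine le_of_mul_le_mul_left ?_ hlam
    calc lam * (G * ∑ t ∈ Finset.Icc 1 (n - τ), |inner ℝ (x (t + τ)) (w t - w (t + τ))|)
        = G * (lam * ∑ t ∈ Finset.Icc 1 (n - τ), |inner ℝ (x (t + τ)) (w t - w (t + τ))|) := by
          ring
      _ ≤ G * (6 * τ * G * Q) := mul_le_mul_of_nonneg_left hstab hG
      _ = lam * (6 * τ * (G ^ 2 / lam) * Q) := by field_simp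
  have hQ : (2 + 6 * τ) * (G ^ 2 / lam) * Q ≤
      (2 + 6 * τ) * (G ^ 2 / lam) * (d * Real.log (B ^ 2 * n + 1)) := by gcongr
  have e : 2 * G ^ 2 / lam * Q + 6 * τ * (G ^ 2 / lam) * Q = (2 + 6 * τ) * (G ^ 2 / lam) * Q := by
    ring
  linarith

end Algorithm

/-! ### Conditional mean and variance bounds for delayed excess losses. -/

section Decoupled

variable {Ω Y : Type*} [MeasurableSpace Ω] [MeasurableSpace Y] {d : ℕ} {P : Measure Ω}
  [IsProbabilityMeasure P] {ξ : ℕ → Ω → EuclideanSpace ℝ (Fin d) × Y}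
  {Pi : Measure (EuclideanSpace ℝ (Fin d) × Y)} [IsProbabilityMeasure Pi] {B R : ℝ}
  {W : Set (EuclideanSpace ℝ (Fin d))} {loss loss' : Y → ℝ → ℝ} {lam G : ℝ}
  {wstar : EuclideanSpace ℝ (Fin d)}

lemma continuousOn_excessLoss_sub_risk (hB : ∀ᵐ z ∂Pi, ‖z.1‖ ≤ B) (hB0 : 0 ≤ B) (hR0 : 0 ≤ R)
    (hWR : ∀ w ∈ W, ‖w‖ ≤ R) (hlam : 0 < lam) (hloss : Measurable (Function.uncurry loss))
    (hlin : LinearStrongConvexity loss loss' lam G (R * B))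
    (hint : ∀ w ∈ W, Integrable (sampleLoss loss w) Pi) (hwstar : wstar ∈ W) (κ : ℝ)
    (z : EuclideanSpace ℝ (Fin d) × Y) :
    ContinuousOn (fun v => excessLoss loss B wstar v z
      - (risk loss Pi v - risk loss Pi wstar) + κ) W := by
  have hG := hlin.lipschitz_const_nonneg (mul_nonneg hR0 hB0) z.2
  have hK : 0 ≤ G * B := mul_nonneg hG hB0
  have h1 : ContinuousOn (fun v => excessLoss loss B wstar v z) W := by
    refine (LipschitzOnWith.of_dist_le_mul (K := ⟨G * B, hK⟩) fun u hu v hv => ?_).continuousOn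
    rw [Real.dist_eq, dist_eq_norm]
    exact abs_excessLoss_sub_le hB0 hR0 hWR hlin hu hv z
  have h2 : ContinuousOn (fun v => risk loss Pi v - risk loss Pi wstar) W := by
    refine (LipschitzOnWith.of_dist_le_mul (K := ⟨G * B, hK⟩) fun u hu v hv => ?_).continuousOn
    rw [Real.dist_eq, dist_eq_norm, ← integral_excessLoss hB hint hwstar hu,
      ← integral_excessLoss hB hint hwstar hv,
      ← integral_sub (integrable_excessLoss hloss hWR hlam hlin hwstar hu)
        (integrable_excessLoss hloss hWR hlam hlin hwstar hv)]
    have h := norm_integral_le_of_norm_le_const (μ := Pi) (C := G * B * ‖u - v‖)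
      (f := fun z => excessLoss loss B wstar u z - excessLoss loss B wstar v z)
      (Filter.Eventually.of_forall fun z => abs_excessLoss_sub_le hB0 hR0 hWR hlin hu hv z)
    change _ ≤ G * B * ‖u - v‖
    simpa using h
  exact (h1.sub h2).add continuousOn_const

/-- Weak form of the conditional mean bound: mixing handles a fixed v, then decoupling inserts the
adapted a. The truncation in `excessLoss` supplies bounds valid at every sample. -/
lemma integral_mul_excessLoss_nonneg (hξ : ∀ t, 1 ≤ t → Measurable (ξ t))
    (hB : ∀ᵐ z ∂Pi, ‖z.1‖ ≤ B) (hB0 : 0 ≤ B) (hR0 : 0 ≤ R)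
    (hWR : ∀ w ∈ W, ‖w‖ ≤ R) (hlam : 0 < lam) (hloss : Measurable (Function.uncurry loss))
    (hlin : LinearStrongConvexity loss loss' lam G (R * B))
    (hint : ∀ w ∈ W, Integrable (sampleLoss loss w) Pi) (hwstar : wstar ∈ W)
    (hmin : IsMinOn (risk loss Pi) W wstar)
    {t : ℕ} (ht : 1 ≤ t) (τ : ℕ) {a : Ω → EuclideanSpace ℝ (Fin d)}
    (ha : Measurable[history ξ t] a) (haW : ∀ ω, a ω ∈ W)
    (Z : Ω → ℝ) (hZ : Measurable[history ξ t] Z) (hZ0 : ∀ ω, 0 ≤ Z ω)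
    (hZC : ∃ C, ∀ ω, Z ω ≤ C) :
    0 ≤ ∫ ω, Z ω * (excessLoss loss B wstar (a ω) (ξ (t + τ) ω)
      - (risk loss Pi (a ω) - risk loss Pi wstar)
      + 2 * G ^ 2 / lam * phiMixing P ξ Pi τ) ∂P := by
  obtain ⟨C, hC⟩ := hZC
  set M := 2 * G ^ 2 / lam with hM
  have hM0 : 0 ≤ M := by positivity
  set κ := M * phiMixing P ξ Pi τ
  have hξt := hξ (t + τ) (by omega)
  have hexm := measurable_uncurry_excessLoss (B := B) (wstar := wstar) hloss
  have hDC : ∀ v ∈ W, ∀ z, |excessLoss loss B wstar v z - (risk loss Pi v - risk loss Pi wstar)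
      + κ| ≤ M + M + |κ| := by
    intro v hv z
    refine (abs_add_le _ _).trans (add_le_add_left ((abs_sub _ _).trans (add_le_add ?_ ?_)) _)
    · exact abs_excessLoss_le hWR hlam hlin hwstar hv z
    · rw [abs_of_nonneg (sub_nonneg.2 (hmin hv))]
      exact risk_sub_le hB hWR hlam hlin hint hwstar hv
  have hDm : Measurable (Function.uncurry fun (v : EuclideanSpace ℝ (Fin d)) z =>
      excessLoss loss B wstar v z - (risk loss Pi v - risk loss Pi wstar) + κ) :=
    (hexm.sub (((measurable_risk hloss).comp measurable_fst).sub_const _)).add_const _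
  refine integral_mul_apply_nonneg (history_le hξ t) hDm hDC
    (continuousOn_excessLoss_sub_risk hB hB0 hR0 hWR hlam hloss hlin hint hwstar κ)
    ha haW hξt (fun v hv Z' hZ' hZ'0 hZ'C => ?_) hZ hZ0 hC
  obtain ⟨C', hC'⟩ := hZ'C
  have hfixm : Measurable fun z => excessLoss loss B wstar v z := hexm.of_uncurry_left
  refine integral_mul_nonneg_of_setIntegral_nonneg (history_le hξ t) ?_ (fun A hA => ?_)
    hZ' hZ'0 hC'
  · exact Integrable.of_bound (C := M + M + |κ|)
      (((hfixm.comp hξt).sub_const _).add_const _).aestronglyMeasurable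
      (Filter.Eventually.of_forall fun ω => hDC v hv _)
  · rw [← integral_excessLoss hB hint hwstar hv]
    exact setIntegral_mixing_nonneg hξ ht τ hfixm hM0
      (fun z => abs_excessLoss_le hWR hlam hlin hwstar hv z) hA

/-- Bernstein-type condition: the excess loss is at most GB‖v - w*‖, and `risk_growth` bounds ‖v -
w*‖² by the excess risk. -/
lemma sq_excessLoss_le (hB : ∀ᵐ z ∂Pi, ‖z.1‖ ≤ B) (hB0 : 0 ≤ B) (hR0 : 0 ≤ R)
    (hWconv : Convex ℝ W) (hWR : ∀ w ∈ W, ‖w‖ ≤ R) (hlam : 0 < lam)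
    (hlin : LinearStrongConvexity loss loss' lam G (R * B))
    (hint : ∀ w ∈ W, Integrable (sampleLoss loss w) Pi)
    (hcov : 0 < lambdaMin (secondMoment Pi)) (hwstar : wstar ∈ W)
    (hmin : IsMinOn (risk loss Pi) W wstar) {v : EuclideanSpace ℝ (Fin d)} (hv : v ∈ W)
    (z : EuclideanSpace ℝ (Fin d) × Y) :
    (excessLoss loss B wstar v z) ^ 2 ≤ 2 * G ^ 2 * B ^ 2 / (lam * lambdaMin (secondMoment Pi))
      * (risk loss Pi v - risk loss Pi wstar) := by
  have hgrow := risk_growth hB hWconv hWR hlam hlin hint hwstar hmin hv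
  have h0 : excessLoss loss B wstar wstar z = 0 := by simp [excessLoss]
  have h1 := abs_excessLoss_sub_le (wstar := wstar) hB0 hR0 hWR hlin hv hwstar z
  rw [h0, sub_zero] at h1
  set μ := lambdaMin (secondMoment Pi)
  calc (excessLoss loss B wstar v z) ^ 2 ≤ (G * B * ‖v - wstar‖) ^ 2 := by
        rw [← sq_abs]; exact pow_le_pow_left₀ (abs_nonneg _) h1 2
    _ = 2 * G ^ 2 * B ^ 2 / (lam * μ) * (lam / 2 * μ * ‖v - wstar‖ ^ 2) := by
        field_simp
    _ ≤ _ := by gcongr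

end Decoupled

/-! ### Comparison of constants with the stated bound. -/

section Bound

/-- The right-hand side of the generalization bound. -/
def riskBound (d : ℕ) (B lam G μ ρ : ℝ) (φ : ℕ → ℝ) (n : ℕ) (δ : ℝ) (τ : ℕ) : ℝ :=
  G ^ 2 * d / (lam * n) * (9 + 14 * τ) * Real.log (B ^ 2 * n + 1)
    + lam / n * ρ ^ 2
    + 32 * G ^ 2 * B ^ 2 * τ / (lam * n * μ) * Real.log (τ / δ)
    + 8 * τ * G ^ 2 / (lam * n) * (3 * Real.log (τ / δ) + 1)
    + 4 * G ^ 2 / lam * φ τ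

variable {d n τ : ℕ} {B lam G μ ρ δ : ℝ} {φ : ℕ → ℝ}

lemma log_inv_le_log_div (hτ : 1 ≤ τ) (hδ0 : 0 < δ) :
    Real.log (1 / δ) ≤ Real.log (τ / δ) := by
  have : (1 : ℝ) ≤ τ := by exact_mod_cast hτ
  exact Real.log_le_log (by positivity) (by gcongr)

lemma log_inv_nonneg (hδ0 : 0 < δ) (hδ1 : δ < 1) : 0 ≤ Real.log (1 / δ) :=
  Real.log_nonneg (by rw [le_div_iff₀ hδ0]; linarith)

/-- The term 8τG²/(λn) alone suffices once τ ≥ n. -/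
lemma le_riskBound_of_le (hlam : 0 < lam) (hμ : 0 < μ) (hφ : 0 ≤ φ τ) (hn : 1 ≤ n) (hnτ : n ≤ τ)
    (hδ0 : 0 < δ) (hδ1 : δ < 1) : 2 * G ^ 2 / lam ≤ riskBound d B lam G μ ρ φ n δ τ := by
  have hL : 0 ≤ Real.log (τ / δ) :=
    (log_inv_nonneg hδ0 hδ1).trans (log_inv_le_log_div (hn.trans hnτ) hδ0)
  have hlog : 0 ≤ Real.log (B ^ 2 * n + 1) := Real.log_nonneg (by
    have : 0 ≤ B ^ 2 * n := by positivity
    linarith)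
  have hn0 : (0 : ℝ) < n := by positivity
  have hnτ' : (n : ℝ) ≤ τ := by exact_mod_cast hnτ
  have h1 : 0 ≤ G ^ 2 * d / (lam * n) * (9 + 14 * τ) * Real.log (B ^ 2 * n + 1) := by positivity
  have h2 : 0 ≤ lam / n * ρ ^ 2 := by positivity
  have h3 : 0 ≤ 32 * G ^ 2 * B ^ 2 * τ / (lam * n * μ) * Real.log (τ / δ) := by positivity
  have h4 : 0 ≤ 4 * G ^ 2 / lam * φ τ := by positivity
  have h5 : 2 * G ^ 2 / lam ≤ 8 * τ * G ^ 2 / (lam * n) * (3 * Real.log (τ / δ) + 1) := by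
    calc 2 * G ^ 2 / lam ≤ 8 * τ * G ^ 2 / (lam * n) * 1 := by
          rw [mul_one, div_le_div_iff₀ hlam (by positivity)]
          have : G ^ 2 * lam * n ≤ G ^ 2 * lam * τ := by gcongr
          have h0 : 0 ≤ G ^ 2 * lam * τ := by positivity
          nlinarith
      _ ≤ _ := by gcongr; linarith
  rw [riskBound]
  linarith

lemma riskBound_nonneg (hlam : 0 < lam) (hμ : 0 < μ) (hφ : 0 ≤ φ τ) (hτ : 1 ≤ τ)
    (hδ0 : 0 < δ) (hδ1 : δ < 1) : 0 ≤ riskBound d B lam G μ ρ φ n δ τ := by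
  have hL : 0 ≤ Real.log (τ / δ) :=
    (log_inv_nonneg hδ0 hδ1).trans (log_inv_le_log_div hτ hδ0)
  have hlog : 0 ≤ Real.log (B ^ 2 * n + 1) := Real.log_nonneg (by
    have : 0 ≤ B ^ 2 * n := by positivity
    linarith)
  unfold riskBound
  positivity

/-- Coefficients to compare: 4 + 12τ against 9 + 14τ, 8 against 32, 4 against 24, and 6 against 8;
those of λρ² and φ agree exactly. -/
lemma le_riskBound {a : ℝ} (hlam : 0 < lam) (hμ : 0 < μ) (hn : 1 ≤ n) (hτ : 1 ≤ τ)
    (hδ0 : 0 < δ) (hδ1 : δ < 1)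
    (ha : n * a ≤ 2 * τ * Real.log (1 / δ) * (2 * (2 * G ^ 2 * B ^ 2 / (lam * μ)) + 2 * G ^ 2 / lam)
      + 2 * (lam / 2 * ρ ^ 2 + (2 + 6 * τ) * (G ^ 2 / lam) * (d * Real.log (B ^ 2 * n + 1))
        + τ * (2 * G ^ 2 / lam))
      + 2 * (n * (2 * G ^ 2 / lam * φ τ)) + τ * (2 * G ^ 2 / lam)) :
    a ≤ riskBound d B lam G μ ρ φ n δ τ := by
  have hn0 : (0 : ℝ) < n := by positivity
  have hL0 := log_inv_nonneg hδ0 hδ1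
  have hL := log_inv_le_log_div hτ hδ0
  have hlog : 0 ≤ Real.log (B ^ 2 * n + 1) := Real.log_nonneg (by
    have : 0 ≤ B ^ 2 * n := by positivity
    linarith)
  set L := Real.log (τ / δ)
  set l := Real.log (1 / δ)
  set Λ := Real.log (B ^ 2 * n + 1)
  refine le_of_mul_le_mul_left (ha.trans ?_) hn0
  have e : n * riskBound d B lam G μ ρ φ n δ τ = (9 + 14 * τ) * (G ^ 2 / lam * (d * Λ))
      + lam * ρ ^ 2 + 32 * (τ * (G ^ 2 * B ^ 2 / (lam * μ)) * L)
      + 24 * (τ * (G ^ 2 / lam) * L) + 8 * (τ * (G ^ 2 / lam))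
      + 4 * (n * (G ^ 2 / lam * φ τ)) := by
    rw [riskBound, show Real.log (τ / δ) = L from rfl, show Real.log (B ^ 2 * n + 1) = Λ from rfl]
    field_simp
    ring
  have h1 : 0 ≤ G ^ 2 / lam * (d * Λ) := by positivity
  have h2 : 0 ≤ τ * (G ^ 2 / lam * (d * Λ)) := by positivity
  have h3 : τ * (G ^ 2 * B ^ 2 / (lam * μ)) * l ≤ τ * (G ^ 2 * B ^ 2 / (lam * μ)) * L := by gcongr
  have h4 : τ * (G ^ 2 / lam) * l ≤ τ * (G ^ 2 / lam) * L := by gcongr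
  have h5 : 0 ≤ τ * (G ^ 2 / lam) := by positivity
  have h6 : 0 ≤ τ * (G ^ 2 * B ^ 2 / (lam * μ)) * l := by positivity
  have h7 : 0 ≤ τ * (G ^ 2 / lam) * l := by positivity
  rw [e]
  have e2 : 2 * τ * l * (2 * (2 * G ^ 2 * B ^ 2 / (lam * μ)) + 2 * G ^ 2 / lam)
      = 8 * (τ * (G ^ 2 * B ^ 2 / (lam * μ)) * l) + 4 * (τ * (G ^ 2 / lam) * l) := by ring
  have e3 : (2 + 6 * τ) * (G ^ 2 / lam) * (d * Λ)
      = 2 * (G ^ 2 / lam * (d * Λ)) + 6 * (τ * (G ^ 2 / lam * (d * Λ))) := by ring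
  have e4 : τ * (2 * G ^ 2 / lam) = 2 * (τ * (G ^ 2 / lam)) := by ring
  have e5 : n * (2 * G ^ 2 / lam * φ τ) = 2 * (n * (G ^ 2 / lam * φ τ)) := by ring
  have e6 : (9 + 14 * τ) * (G ^ 2 / lam * (d * Λ))
      = 9 * (G ^ 2 / lam * (d * Λ)) + 14 * (τ * (G ^ 2 / lam * (d * Λ))) := by ring
  rw [e2, e3, e4, e5, e6]
  linarith

end Bound

/-! ### Self-bounding concentration and the fixed-lag bound. -/

/-- Concentration for self-bounding losses: if, given the past, `h t` has conditional mean at least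
`Δ t - κ` and second moment at most `c * Δ t`, then `∑ Δ t` is controlled by `∑ h t`. -/
theorem measureReal_sum_gt_le {Ω : Type*} [mΩ : MeasurableSpace Ω] {P : Measure Ω}
    [IsProbabilityMeasure P] {m : ℕ → MeasurableSpace Ω} (hm : ∀ t, m t ≤ mΩ) (hmono : Monotone m)
    {τ : ℕ} (hτ : 1 ≤ τ) {h Δ : ℕ → Ω → ℝ} {M c κ : ℝ} (hM0 : 0 < M) (hc0 : 0 ≤ c) (hκ0 : 0 ≤ κ)
    (hhm : ∀ t, 1 ≤ t → Measurable[m (t + τ)] (h t)) (hΔm : ∀ t, 1 ≤ t → Measurable[m t] (Δ t))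
    (hhM : ∀ t, 1 ≤ t → ∀ ω, |h t ω| ≤ M) (hΔ0 : ∀ t, 1 ≤ t → ∀ ω, 0 ≤ Δ t ω)
    (hΔM : ∀ t, 1 ≤ t → ∀ ω, Δ t ω ≤ M) (hhc : ∀ t, 1 ≤ t → ∀ ω, (h t ω) ^ 2 ≤ c * Δ t ω)
    (hmix : ∀ t, 1 ≤ t → ∀ Z : Ω → ℝ, Measurable[m t] Z → (∀ ω, 0 ≤ Z ω) →
      (∃ C, ∀ ω, Z ω ≤ C) → 0 ≤ ∫ ω, Z ω * (h t ω - Δ t ω + κ) ∂P)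
    (N : ℕ) {δ : ℝ} (hδ0 : 0 < δ) :
    P.real {ω | 2 * τ * Real.log (1 / δ) * (2 * c + M) + 2 * ∑ t ∈ Finset.Icc 1 N, h t ω
        + 2 * (N * κ) < ∑ t ∈ Finset.Icc 1 N, Δ t ω} ≤ δ := by
  -- θM ≤ 1 permits the quadratic bound on exp; θc ≤ 1/2 lets the variance term consume at most half
  -- of θΔ, which is the source of the factors 2.
  set θ := 1 / (2 * c + M) with hθ
  have hθ0 : 0 < θ := by positivity
  have hθM : θ * M ≤ 1 := by rw [hθ, one_div_mul_eq_div, div_le_one (by positivity)]; linarith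
  have hθc : θ * c ≤ 1 / 2 := by
    rw [hθ, one_div_mul_eq_div, div_le_iff₀ (by positivity)]; linarith
  set y : ℕ → Ω → ℝ := fun t ω =>
    -θ * h t ω + (θ * Δ t ω - θ * κ - θ ^ 2 * (c * Δ t ω)) with hy
  have hym : ∀ t, 1 ≤ t → Measurable[m (t + τ)] (y t) := by
    intro t ht
    have hΔm' := (hΔm t ht).mono (hmono (Nat.le_add_right t τ)) le_rfl
    exact ((hhm t ht).const_mul _).add
      (((hΔm'.const_mul θ).sub_const _).sub ((hΔm'.const_mul c).const_mul _))
  have hyC : ∀ t, 1 ≤ t → ∀ ω, |y t ω| ≤ θ * M + (θ * M + θ * κ + θ ^ 2 * (c * M)) := by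
    intro t ht ω
    have h1 : |-θ * h t ω| ≤ θ * M := by
      rw [abs_mul, abs_neg, abs_of_pos hθ0]
      exact mul_le_mul_of_nonneg_left (hhM t ht ω) hθ0.le
    have h2 : θ * Δ t ω ≤ θ * M := mul_le_mul_of_nonneg_left (hΔM t ht ω) hθ0.le
    have h3 : θ ^ 2 * (c * Δ t ω) ≤ θ ^ 2 * (c * M) := by gcongr; exact hΔM t ht ω
    have h4 : 0 ≤ θ * Δ t ω := mul_nonneg hθ0.le (hΔ0 t ht ω)
    have h5 : 0 ≤ θ ^ 2 * (c * Δ t ω) := mul_nonneg (sq_nonneg θ) (mul_nonneg hc0 (hΔ0 t ht ω))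
    have h6 : 0 ≤ θ * κ := mul_nonneg hθ0.le hκ0
    have h7 : 0 ≤ θ * M := mul_nonneg hθ0.le hM0.le
    obtain ⟨h8, h9⟩ := abs_le.1 h1
    rw [abs_le]
    constructor <;> simp only [hy] <;> linarith
  have hstep : ∀ t, 1 ≤ t → ∀ Z : Ω → ℝ, Measurable[m t] Z → (∀ ω, 0 ≤ Z ω) →
      (∃ C', ∀ ω, Z ω ≤ C') → ∫ ω, Z ω * Real.exp (y t ω) ∂P ≤ ∫ ω, Z ω ∂P := by
    intro t ht Z hZ hZ0 ⟨C', hZC⟩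
    exact integral_mul_exp_le (hm t) ((hhm t ht).mono (hm _) le_rfl) (hΔm t ht) hθ0.le hθM
      (hhM t ht) (fun ω => by rw [abs_of_nonneg (hΔ0 t ht ω)]; exact hΔM t ht ω) (hhc t ht)
      (hmix t ht) hZ hZ0 hZC
  have hconc := measureReal_blocked_sum_gt_le (P := P) hm hmono hτ hym hyC hstep N hδ0
  refine le_trans (measureReal_mono fun ω hω => ?_) hconc
  rw [Set.mem_ofPred_eq] at hω ⊢
  set S := ∑ t ∈ Finset.Icc 1 N, Δ t ω with hS
  set H := ∑ t ∈ Finset.Icc 1 N, h t ω with hHdef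
  have hS0 : 0 ≤ S := Finset.sum_nonneg fun t ht => hΔ0 t (Finset.mem_Icc.1 ht).1 ω
  have hysum : ∑ t ∈ Finset.Icc 1 N, y t ω
      = -θ * H + (θ * S - N * (θ * κ) - θ ^ 2 * (c * S)) := by
    simp only [hy, hS, hHdef, Finset.sum_add_distrib, Finset.sum_sub_distrib, Finset.mul_sum,
      Finset.sum_const, Nat.card_Icc, nsmul_eq_mul, Nat.add_sub_cancel]
  have h1 : θ ^ 2 * (c * S) ≤ θ * S * (1 / 2) := by
    have := mul_le_mul_of_nonneg_left hθc (mul_nonneg hθ0.le hS0)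
    linarith
  have h2 := mul_lt_mul_of_pos_left hω hθ0
  have h3 : θ * (2 * τ * Real.log (1 / δ) * (2 * c + M)) = 2 * (τ * Real.log (1 / δ)) := by
    rw [hθ]; field_simp
  rw [mul_add, mul_add, h3] at h2
  rw [hysum]
  linarith

variable {Ω Y : Type*} [MeasurableSpace Ω] [MeasurableSpace Y] {d : ℕ} {P : Measure Ω}
  [IsProbabilityMeasure P] {ξ : ℕ → Ω → EuclideanSpace ℝ (Fin d) × Y}
  {Pi : Measure (EuclideanSpace ℝ (Fin d) × Y)} [IsProbabilityMeasure Pi] {B R : ℝ}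
  {W : Set (EuclideanSpace ℝ (Fin d))} {loss loss' : Y → ℝ → ℝ} {lam G : ℝ}
  {wstar : EuclideanSpace ℝ (Fin d)} {w : ℕ → Ω → EuclideanSpace ℝ (Fin d)}

/-- The cumulative risk of the iterates is controlled by their losses on the samples from `τ`
steps ahead. -/
lemma measureReal_sum_risk_gt_le (hξ : ∀ t, 1 ≤ t → Measurable (ξ t))
    (hB : ∀ᵐ z ∂Pi, ‖z.1‖ ≤ B) (hB0 : 0 ≤ B)
    (hR0 : 0 ≤ R) (hWconv : Convex ℝ W) (hWR : ∀ w ∈ W, ‖w‖ ≤ R)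
    (hloss : Measurable (Function.uncurry loss)) (hloss' : Measurable (Function.uncurry loss'))
    (hlam : 0 < lam) (hG : G ≠ 0) (hlin : LinearStrongConvexity loss loss' lam G (R * B))
    (hint : ∀ w ∈ W, Integrable (sampleLoss loss w) Pi)
    (hcov : 0 < lambdaMin (secondMoment Pi)) (hwstar : wstar ∈ W)
    (hmin : IsMinOn (risk loss Pi) W wstar)
    (hw : ∀ ω, IsFTAL loss' lam 1 W (fun t => ξ t ω) (fun t => w t ω))
    {τ : ℕ} (hτ : 1 ≤ τ) (N : ℕ) {δ : ℝ} (hδ0 : 0 < δ) :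
    P.real {ω | 2 * τ * Real.log (1 / δ)
          * (2 * (2 * G ^ 2 * B ^ 2 / (lam * lambdaMin (secondMoment Pi))) + 2 * G ^ 2 / lam)
        + 2 * ∑ t ∈ Finset.Icc 1 N, excessLoss loss B wstar (w t ω) (ξ (t + τ) ω)
        + 2 * (N * (2 * G ^ 2 / lam * phiMixing P ξ Pi τ)) <
      ∑ t ∈ Finset.Icc 1 N, (risk loss Pi (w t ω) - risk loss Pi wstar)} ≤ δ := by
  have hwW : ∀ t, 1 ≤ t → ∀ ω, w t ω ∈ W := fun t ht ω => (hw ω t ht).1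
  have hwm : ∀ t, 1 ≤ t → Measurable[history ξ t] (w t) :=
    fun t => measurable_iterate hloss' hlam hWconv hw t
  -- G ≠ 0 enters through the requirement 0 < M with M = 2G²/λ.
  exact measureReal_sum_gt_le (history_le hξ) history_mono hτ (by positivity) (by positivity)
    (mul_nonneg (by positivity) (phiMixing_nonneg τ))
    (fun t ht => (measurable_uncurry_excessLoss hloss).comp
      (((hwm t ht).mono (history_mono (Nat.le_add_right t τ)) le_rfl).prodMk
        (measurable_history (by omega) le_rfl)))
    (fun t ht => ((measurable_risk hloss).comp (hwm t ht)).sub_const _)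
    (fun t ht ω => abs_excessLoss_le hWR hlam hlin hwstar (hwW t ht ω) _)
    (fun t ht ω => sub_nonneg.2 (hmin (hwW t ht ω)))
    (fun t ht ω => risk_sub_le hB hWR hlam hlin hint hwstar (hwW t ht ω))
    (fun t ht ω => sq_excessLoss_le hB hB0 hR0 hWconv hWR hlam hlin hint hcov hwstar hmin
      (hwW t ht ω) _)
    (fun t ht => integral_mul_excessLoss_nonneg hξ hB hB0 hR0 hWR hlam hloss hlin hint hwstar hmin
      ht τ (hwm t ht) (hwW t ht)) N hδ0

/-- The generalization bound for a fixed lag `τ ≤ n`. -/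
theorem one_sub_le_measureReal_risk_le (hξ : ∀ t, 1 ≤ t → Measurable (ξ t))
    (hB : ∀ᵐ z ∂Pi, ‖z.1‖ ≤ B) (hξB : ∀ᵐ ω ∂P, ∀ t, 1 ≤ t → ‖(ξ t ω).1‖ ≤ B) (hB0 : 0 ≤ B)
    (hR0 : 0 ≤ R) (hWconv : Convex ℝ W) (hWR : ∀ w ∈ W, ‖w‖ ≤ R)
    (hloss : Measurable (Function.uncurry loss)) (hloss' : Measurable (Function.uncurry loss'))
    (hlam : 0 < lam) (hG : G ≠ 0) (hlin : LinearStrongConvexity loss loss' lam G (R * B))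
    (hint : ∀ w ∈ W, Integrable (sampleLoss loss w) Pi)
    (hcov : 0 < lambdaMin (secondMoment Pi)) (hwstar : wstar ∈ W)
    (hmin : IsMinOn (risk loss Pi) W wstar)
    (hw : ∀ ω, IsFTAL loss' lam 1 W (fun t => ξ t ω) (fun t => w t ω))
    {n τ : ℕ} (hτ : 1 ≤ τ) (hτn : τ ≤ n) {δ : ℝ} (hδ0 : 0 < δ) (hδ1 : δ < 1) :
    1 - δ ≤ P.real {ω | risk loss Pi (avgPredictor (fun t => w t ω) n) - risk loss Pi wstar ≤
      riskBound d B lam G (lambdaMin (secondMoment Pi)) ‖wstar‖ (phiMixing P ξ Pi) n δ τ} := by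
  have hconc := measureReal_sum_risk_gt_le (P := P) (Pi := Pi) hξ hB hB0 hR0 hWconv hWR hloss hloss' hlam hG hlin hint
    hcov hwstar hmin hw hτ (n - τ) hδ0
  set bad : Set Ω := {ω | 2 * τ * Real.log (1 / δ)
          * (2 * (2 * G ^ 2 * B ^ 2 / (lam * lambdaMin (secondMoment Pi))) + 2 * G ^ 2 / lam)
        + 2 * ∑ t ∈ Finset.Icc 1 (n - τ), excessLoss loss B wstar (w t ω) (ξ (t + τ) ω)
        + 2 * ((n - τ : ℕ) * (2 * G ^ 2 / lam * phiMixing P ξ Pi τ)) <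
      ∑ t ∈ Finset.Icc 1 (n - τ), (risk loss Pi (w t ω) - risk loss Pi wstar)} with hbad
  -- Subadditivity gives this without measurability of `bad`.
  have hcompl : 1 - δ ≤ P.real badᶜ := by
    have h := measureReal_union_le (μ := P) bad badᶜ
    rw [Set.union_compl_self, probReal_univ] at h
    linarith
  refine hcompl.trans (ENNReal.toReal_mono (measure_ne_top _ _) (measure_mono_ae ?_))
  filter_upwards [hξB] with ω hω hgood
  have hsum : ω ∉ bad := hgood
  rw [hbad, Set.mem_ofPred_eq, not_lt] at hsum
  change risk loss Pi _ - risk loss Pi wstar ≤ _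
  have hn : 1 ≤ n := hτ.trans hτn
  have hwW : ∀ t, 1 ≤ t → w t ω ∈ W := fun t ht => (hw ω t ht).1
  refine le_riskBound hlam hcov hn hτ hδ0 hδ1 ?_
  have hH := (hw ω).sum_excessLoss_le hlam hWconv hWR hB0 hR0 hlin hwstar hω hτn
  refine (risk_avgPredictor_le (convexOn_risk hB hWconv hWR hlam hlin hint) hwW hn).trans ?_
  -- The last τ iterates have no sample τ steps ahead among the first n; each costs at most 2G²/λ.
  have htail : ∑ t ∈ Finset.Icc 1 n, (risk loss Pi (w t ω) - risk loss Pi wstar)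
      ≤ ∑ t ∈ Finset.Icc 1 (n - τ), (risk loss Pi (w t ω) - risk loss Pi wstar)
        + τ * (2 * G ^ 2 / lam) := by
    have e := Finset.sum_Ioc_consecutive
      (fun t => risk loss Pi (w t ω) - risk loss Pi wstar) (Nat.zero_le _) (Nat.sub_le n τ)
    have h1 : ∑ t ∈ Finset.Ioc (n - τ) n, (risk loss Pi (w t ω) - risk loss Pi wstar)
        ≤ ∑ _t ∈ Finset.Ioc (n - τ) n, 2 * G ^ 2 / lam :=
      Finset.sum_le_sum fun t ht => risk_sub_le hB hWR hlam hlin hint hwstar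
        (hwW t (by have := (Finset.mem_Ioc.1 ht).1; omega))
    rw [Finset.sum_const, Nat.card_Ioc, nsmul_eq_mul, Nat.sub_sub_self hτn] at h1
    exact e.symm.le.trans (add_le_add_right h1 _)
  have hcount : ((n - τ : ℕ) : ℝ) * (2 * G ^ 2 / lam * phiMixing P ξ Pi τ)
      ≤ n * (2 * G ^ 2 / lam * phiMixing P ξ Pi τ) :=
    mul_le_mul_of_nonneg_right (by exact_mod_cast Nat.sub_le n τ)
      (mul_nonneg (by positivity) (phiMixing_nonneg τ))
  linarith

end LinearPrediction

end

/-! ### Uniformity over all lags. -/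

theorem mainTheorem5
    {Ω Y : Type*} [MeasurableSpace Ω] [MeasurableSpace Y] {d : ℕ}
    -- the process of samples `(x_t, y_t)`, `t ≥ 1`, and the stationary distribution
    (P : Measure Ω) [IsProbabilityMeasure P]
    (ξ : ℕ → Ω → EuclideanSpace ℝ (Fin d) × Y) (hξ : ∀ t, 1 ≤ t → Measurable (ξ t))
    (Pi : Measure (EuclideanSpace ℝ (Fin d) × Y)) [IsProbabilityMeasure Pi]
    -- the underlying measure, and the bound on the samples
    (ν : Measure (EuclideanSpace ℝ (Fin d) × Y))
    (hPiν : Pi ≪ ν) (hξν : ∀ t, 1 ≤ t → P.map (ξ t) ≪ ν)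
    (B : ℝ) (hB : ∀ᵐ z ∂ν, ‖z.1‖ ≤ B)
    -- the domain
    (W : Set (EuclideanSpace ℝ (Fin d))) (hWconv : Convex ℝ W) (hWcomp : IsCompact W)
    (R : ℝ) (hWR : ∀ w ∈ W, ‖w‖ ≤ R)
    -- the loss
    (loss loss' : Y → ℝ → ℝ)
    (hloss : Measurable (Function.uncurry loss)) (hloss' : Measurable (Function.uncurry loss'))
    (lam G : ℝ) (hlam : 0 < lam)
    (hlin : LinearPrediction.LinearStrongConvexity loss loss' lam G (R * B))
    (hint : ∀ w ∈ W, Integrable (LinearPrediction.sampleLoss loss w) Pi)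
    (hcov : 0 < LinearPrediction.lambdaMin (LinearPrediction.secondMoment Pi))
    -- a minimizer of the risk, and the iterates of the algorithm with `ε = 1`
    (wstar : EuclideanSpace ℝ (Fin d)) (hwstar : wstar ∈ W)
    (hmin : IsMinOn (LinearPrediction.risk loss Pi) W wstar)
    (w : ℕ → Ω → EuclideanSpace ℝ (Fin d))
    (hw : ∀ ω, LinearPrediction.IsFTAL loss' lam 1 W (fun t => ξ t ω) (fun t => w t ω))
    (n : ℕ) (hn : 1 ≤ n) (δ : ℝ) (hδ0 : 0 < δ) (hδ1 : δ < 1) :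
    1 - 4 * δ * Real.log n ≤
      P.real {ω | ∀ τ : ℕ, 1 ≤ τ →
        LinearPrediction.risk loss Pi (LinearPrediction.avgPredictor (fun t => w t ω) n)
            - LinearPrediction.risk loss Pi wstar ≤
          G ^ 2 * d / (lam * n) * (9 + 14 * τ) * Real.log (B ^ 2 * n + 1)
          + lam / n * ‖wstar‖ ^ 2
          + 32 * G ^ 2 * B ^ 2 * τ
              / (lam * n * LinearPrediction.lambdaMin (LinearPrediction.secondMoment Pi))
              * Real.log (τ / δ)
          + 8 * τ * G ^ 2 / (lam * n) * (3 * Real.log (τ / δ) + 1)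
          + 4 * G ^ 2 / lam * LinearPrediction.phiMixing P ξ Pi τ} := by
  have hPiB : ∀ᵐ z ∂Pi, ‖z.1‖ ≤ B := hPiν.ae_le hB
  have hξB : ∀ᵐ ω ∂P, ∀ t, 1 ≤ t → ‖(ξ t ω).1‖ ≤ B := by
    rw [ae_all_iff]
    intro t
    by_cases ht : 1 ≤ t
    · filter_upwards [ae_of_ae_map (hξ t ht).aemeasurable ((hξν t ht).ae_le hB)] with ω hω _
      exact hω
    · exact Filter.Eventually.of_forall fun ω h => absurd h ht
  have hB0 : 0 ≤ B := by
    obtain ⟨z, hz⟩ := hPiB.exists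
    exact (norm_nonneg _).trans hz
  have hR0 : 0 ≤ R := (norm_nonneg _).trans (hWR wstar hwstar)
  have hφ : ∀ τ, 0 ≤ LinearPrediction.phiMixing P ξ Pi τ :=
    fun τ => LinearPrediction.phiMixing_nonneg τ
  set μ := LinearPrediction.lambdaMin (LinearPrediction.secondMoment Pi) with hμ
  set rhs : ℕ → ℝ := LinearPrediction.riskBound d B lam G μ ‖wstar‖
    (LinearPrediction.phiMixing P ξ Pi) n δ with hrhs
  set X : Ω → ℝ := fun ω => LinearPrediction.risk loss Pi
    (LinearPrediction.avgPredictor (fun t => w t ω) n) - LinearPrediction.risk loss Pi wstar with hX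
  change 1 - 4 * δ * Real.log n ≤ P.real {ω | ∀ τ : ℕ, 1 ≤ τ → X ω ≤ rhs τ}
  have hXM : ∀ ω, X ω ≤ 2 * G ^ 2 / lam := fun ω =>
    LinearPrediction.risk_sub_le hPiB hWR hlam hlin hint hwstar
      (LinearPrediction.avgPredictor_mem hWconv (fun t ht => (hw ω t ht).1) hn)
  have hlarge : ∀ τ, n ≤ τ → ∀ ω, X ω ≤ rhs τ := fun τ hτ ω =>
    (hXM ω).trans (LinearPrediction.le_riskBound_of_le hlam hcov (hφ τ) hn hτ hδ0 hδ1)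
  have hlog0 : 0 ≤ 4 * δ * Real.log n := mul_nonneg (by positivity) (Real.log_natCast_nonneg n)
  -- If the bound can fail somewhere, then G ≠ 0, and n ≥ 2 because every lag τ ≥ n is already
  -- covered.
  by_cases hsure : ∀ τ, 1 ≤ τ → ∀ ω, X ω ≤ rhs τ
  · have huniv : {ω | ∀ τ : ℕ, 1 ≤ τ → X ω ≤ rhs τ} = Set.univ :=
      Set.eq_univ_of_forall fun ω τ hτ => hsure τ hτ ω
    rw [huniv, probReal_univ]
    linarith
  have hG : G ≠ 0 := by
    rintro rfl
    refine hsure fun τ hτ ω => (hXM ω).trans ?_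
    simpa using LinearPrediction.riskBound_nonneg hlam hcov (hφ τ) hτ hδ0 hδ1
  have hn2 : 2 ≤ n := by
    by_contra hlt
    exact hsure fun τ hτ ω => hlarge τ (by omega) ω
  -- σ is deterministic, so the single event for σ implies the bound for every τ ≤ n.
  obtain ⟨σ, hσ, hσmin⟩ := Finset.exists_min_image (Finset.Icc 1 n) rhs
    ⟨1, Finset.mem_Icc.2 ⟨le_rfl, hn⟩⟩
  obtain ⟨hσ1, hσn⟩ := Finset.mem_Icc.1 hσ
  have hmain := LinearPrediction.one_sub_le_measureReal_risk_le hξ hPiB hξB hB0 hR0 hWconv hWR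
    hloss hloss' hlam hG hlin hint hcov hwstar hmin hw hσ1 hσn hδ0 hδ1
  -- Since 4 log 2 > 1, the failure probability δ is within 4δ log n.
  have hlog : 1 ≤ 4 * Real.log n := by
    have h1 : Real.log 2 ≤ Real.log n := Real.log_le_log two_pos (by exact_mod_cast hn2)
    linarith [Real.log_two_gt_d9]
  calc 1 - 4 * δ * Real.log n ≤ 1 - δ := by nlinarith
    _ ≤ P.real {ω | X ω ≤ rhs σ} := hmain
    _ ≤ P.real {ω | ∀ τ : ℕ, 1 ≤ τ → X ω ≤ rhs τ} := by
        refine measureReal_mono fun ω hω τ hτ => ?_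
        rcases le_total n τ with h | h
        · exact hlarge τ h ω
        · exact le_trans hω (hσmin τ (Finset.mem_Icc.2 ⟨hτ, h⟩))
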